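/- Let $\mathcal C\subset\mathbb R^n$ be nonempty and closed with compact boundary, let $\mathbf d(x)$ be the Euclidean distance from $x$ to $\mathcal C$, and let $U\subseteq\mathbb R^m$ be a closed cone. Let $f:(\mathbb R^n\setminus\mathcal C)\times U\to\mathbb R^n$ satisfy **(Hl)** $f$ is continuous and, for all compact sets $\mathcal K\subset\mathbb R^n\setminus\mathcal C$ and $U_1\subset U$, there is $L>0$ such that $|f(x,u)-f(y,u)|\le L|x-y|$ for all $x,y\in\mathcal K$ and $u\in U_1$. An *admissible trajectory-control pair* is a pair $(x,u)$ for which there is $T_x\in(0,+\infty]$ such that $u\in L^\infty_{loc}([0,T_x),U)$, $x\in AC_{loc}([0,T_x),\mathbb R^n\setminus\mathcal C)$, $\dot x(t)=f(x(t),u(t))$ for a.e. $t\in[0,T_x)$ and, if $T_x<+\infty$, $\lim_{t\to T_x^-}\mathbf d(x(t))=0$. If $T_x<+\infty$, $x$ is extended to $[0,+\infty)$ by a constant value $\bar z$ on $[T_x,+\infty)$, where $\bar z\in\partial\mathcal C$ is the limit of $x(\tau_i)$ for some sequence $\tau_i\uparrow T_x$. Let $\mathcal{KL}$ be the set of continuous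 functions $\beta:[0,+\infty)^2\to[0,+\infty)$ such that $\beta(0,t)=0$ and $\beta(\cdot,t)$ is strictly increasing and unbounded for each $t\ge0$, $\beta(r,\cdot)$ is strictly decreasing for each $r>0$, and $\beta(r,t)\to0$ as $t\to+\infty$ for each $r\ge0$. The system $\dot x=f(x,u)$, $u\in U$, is *globally asymptotically controllable (GAC) to* $\mathcal C$ if there is $\beta\in\mathcal{KL}$ such that for every $z\in\mathbb R^n\setminus\mathcal C$ there is an admissible trajectory-control pair $(x,u)$ with $x(0)=z$ and $\mathbf d(x(t))\le\beta(\mathbf d(z),t)$ for all $t\ge0$. Given a continuous $\sigma:(0,+\infty)\to(0,+\infty)$, it is *GAC to $\mathcal C$ with $U\cap\sigma$ controls* if there is $\beta\in\mathcal{KL}$ such that for every $z\in\mathbb R^n\setminus\mathcal C$ there is such a pair that satisfies, in addition, $|u(t)|\le\sigma(\mathbf d(x(t)))$ for a.e. $t\in[0,T_x)$. **Theorem.** The system $\dot x=f(x,u)$, $u\in U$, is GAC to $\mathcal C$ if and only if there is a continuous function $\sigma:(0,+\infty)\to(0,+\infty)$ (possibly with $\sigma(r)\to+\infty$ as $r\to0^+$)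 such that it is GAC to $\mathcal C$ with $U\cap\sigma$ controls. -/

import Mathlib

open Set Filter Topology MeasureTheory

/-- Class `𝒦ℒ` (descent rates): continuous functions `β : [0,∞) × [0,∞) → [0,∞)`, here represented
by functions on `ℝ × ℝ` of which only the values on `[0,∞) × [0,∞)` matter.
Strict decrease in `t` is required for `r > 0` only, since `β(0,t) = 0` for all `t`. -/
structure IsKL (β : ℝ → ℝ → ℝ) : Prop where
  continuousOn : ContinuousOn (fun p : ℝ × ℝ => β p.1 p.2) (Ici 0 ×ˢ Ici 0)
  nonneg : ∀ r, 0 ≤ r → ∀ t, 0 ≤ t → 0 ≤ β r t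
  zero : ∀ t, 0 ≤ t → β 0 t = 0
  strictMonoOn : ∀ t, 0 ≤ t → StrictMonoOn (fun r => β r t) (Ici 0)
  unbounded : ∀ t, 0 ≤ t → ¬ BddAbove ((fun r => β r t) '' Ici 0)
  strictAntiOn : ∀ r, 0 < r → StrictAntiOn (fun t => β r t) (Ici 0)
  tendsto_zero : ∀ r, 0 ≤ r → Tendsto (fun t => β r t) atTop (𝓝 0)

/-- The half-open time interval `[0, T)`, where `T ≤ +∞`. -/
def timeInterval (T : EReal) : Set ℝ := {t : ℝ | 0 ≤ t ∧ (t : EReal) < T}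

section Control

variable {n m : ℕ}

/-- `𝐝(x) = d(x, 𝒞)`, the Euclidean distance from the target. -/
noncomputable def targetDist (C : Set (EuclideanSpace ℝ (Fin n)))
    (x : EuclideanSpace ℝ (Fin n)) : ℝ := Metric.infDist x C

/-- The set `𝒞_x` of the points of `∂𝒞` that are limits of `x(τ_i)` for some sequence
`τ_i ↑ T` in `[0,T)`, for a finite final time `T`. -/
def terminalPoints (C : Set (EuclideanSpace ℝ (Fin n))) (x : ℝ → EuclideanSpace ℝ (Fin n))
    (T : ℝ) : Set (EuclideanSpace ℝ (Fin n)) :=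
  {ζ | ζ ∈ frontier C ∧ ∃ τ : ℕ → ℝ, Monotone τ ∧ (∀ i, 0 ≤ τ i ∧ τ i < T) ∧
    Tendsto τ atTop (𝓝 T) ∧ Tendsto (fun i => x (τ i)) atTop (𝓝 ζ)}

/-- `(x,u)` is an admissible trajectory-control pair for `(f,U)` with final time `T_x = T ≤ +∞`,
the trajectory `x` being already extended to `[0,∞)` when `T < +∞`.
Only the values of `f` on `(ℝⁿ ∖ 𝒞) × U`, of `x` on `[0,∞)` and of `u` on `[0,T)` matter. -/
structure IsAdmissiblePair (C : Set (EuclideanSpace ℝ (Fin n)))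
    (U : Set (EuclideanSpace ℝ (Fin m)))
    (f : EuclideanSpace ℝ (Fin n) → EuclideanSpace ℝ (Fin m) → EuclideanSpace ℝ (Fin n))
    (x : ℝ → EuclideanSpace ℝ (Fin n)) (u : ℝ → EuclideanSpace ℝ (Fin m)) (T : EReal) :
    Prop where
  time_pos : 0 < T
  /-- `u ∈ L^∞_loc([0,T), U)`. -/
  control_mem : ∀ t ∈ timeInterval T, u t ∈ U
  control_memLp : ∀ s ∈ timeInterval T, MemLp u ⊤ (volume.restrict (Icc 0 s))
  /-- `x ∈ AC_loc([0,T), ℝⁿ ∖ 𝒞)`. -/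
  traj_notMem : ∀ t ∈ timeInterval T, x t ∉ C
  traj_ac : ∀ s ∈ timeInterval T, AbsolutelyContinuousOnInterval x 0 s
  /-- `ẋ(t) = f(x(t),u(t))` for a.e. `t ∈ [0,T)`. -/
  ode : ∀ᵐ t ∂volume, t ∈ timeInterval T → HasDerivAt x (f (x t) (u t)) t
  /-- If `T < +∞`, then `𝐝(x(t)) → 0` as `t → T⁻`. -/
  reaches : ∀ S : ℝ, T = (S : EReal) → Tendsto (fun t => targetDist C (x t)) (𝓝[<] S) (𝓝 0)
  /-- If `T < +∞`, then `x` is constant on `[T,∞)`, equal to a point of `𝒞_x`. -/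
  extended : ∀ S : ℝ, T = (S : EReal) → ∃ ζ ∈ terminalPoints C x S, ∀ t, S ≤ t → x t = ζ

/-- Global asymptotic controllability to `𝒞` of `ẋ = f(x,u)`, `u ∈ U`. -/
def IsGAC (C : Set (EuclideanSpace ℝ (Fin n))) (U : Set (EuclideanSpace ℝ (Fin m)))
    (f : EuclideanSpace ℝ (Fin n) → EuclideanSpace ℝ (Fin m) → EuclideanSpace ℝ (Fin n)) :
    Prop :=
  ∃ β : ℝ → ℝ → ℝ, IsKL β ∧ ∀ z, z ∉ C →
    ∃ (x : ℝ → EuclideanSpace ℝ (Fin n)) (u : ℝ → EuclideanSpace ℝ (Fin m)) (T : EReal),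
      IsAdmissiblePair C U f x u T ∧ x 0 = z ∧
      ∀ t, 0 ≤ t → targetDist C (x t) ≤ β (targetDist C z) t

/-- Global asymptotic controllability to `𝒞` of `ẋ = f(x,u)`, `u ∈ U`, with `U ∩ σ` controls;
`σ` is meant to be a continuous function from `(0,∞)` to `(0,∞)`. -/
def IsGACWith (C : Set (EuclideanSpace ℝ (Fin n))) (U : Set (EuclideanSpace ℝ (Fin m)))
    (f : EuclideanSpace ℝ (Fin n) → EuclideanSpace ℝ (Fin m) → EuclideanSpace ℝ (Fin n))
    (σ : ℝ → ℝ) : Prop :=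
  ∃ β : ℝ → ℝ → ℝ, IsKL β ∧ ∀ z, z ∉ C →
    ∃ (x : ℝ → EuclideanSpace ℝ (Fin n)) (u : ℝ → EuclideanSpace ℝ (Fin m)) (T : EReal),
      IsAdmissiblePair C U f x u T ∧ x 0 = z ∧
      (∀ t, 0 ≤ t → targetDist C (x t) ≤ β (targetDist C z) t) ∧
      ∀ᵐ t ∂volume, t ∈ timeInterval T → ‖u t‖ ≤ σ (targetDist C (x t))

/-- Hypothesis (Hl): `f` is continuous on `(ℝⁿ ∖ 𝒞) × U` and locally Lipschitz continuous in `x`,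
uniformly on compact sets of controls. -/
structure HypHl (C : Set (EuclideanSpace ℝ (Fin n))) (U : Set (EuclideanSpace ℝ (Fin m)))
    (f : EuclideanSpace ℝ (Fin n) → EuclideanSpace ℝ (Fin m) → EuclideanSpace ℝ (Fin n)) :
    Prop where
  continuousOn : ContinuousOn
    (fun p : EuclideanSpace ℝ (Fin n) × EuclideanSpace ℝ (Fin m) => f p.1 p.2) (Cᶜ ×ˢ U)
  lipschitz : ∀ K : Set (EuclideanSpace ℝ (Fin n)), IsCompact K → K ⊆ Cᶜ →
    ∀ U₁ : Set (EuclideanSpace ℝ (Fin m)), IsCompact U₁ → U₁ ⊆ U →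
      ∃ L : ℝ, 0 < L ∧ ∀ x ∈ K, ∀ y ∈ K, ∀ u ∈ U₁, ‖f x u - f y u‖ ≤ L * ‖x - y‖

end Control

/-! Only the direction that produces `σ` needs work; for the converse the same `β` serves. The
distance to the target is halved repeatedly, each time with controls bounded uniformly over a shell.

A GAC trajectory from a point of the shell `r/2 ≤ 𝐝 ≤ r` gets below `r/4` in finite time, and its
control is essentially bounded up to that time. By continuous dependence
(`IsTrajOn.exists_perturbed`) the same control brings all nearby points to level `r/2`. The shell is
compact because `∂𝒞` is, so finitely many controls suffice, and `exists_halving_steps` obtains a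
control bound `M`, a time bound `τ` and an overshoot bound `β(r,0) + r`, all uniform on the shell.

With `r = 2^(-k)`, `k ∈ ℤ`, these steps are concatenated (`exists_admissible_of_halving_steps`); the
final time is the supremum of the switching times, finite or not. During step `k` the distance lies
between `2^(-(k+1))` and `B k`, where `B k → 0`. So a given distance occurs in finitely many steps
only, and the bounds `M k` have a continuous majorant `σ` (`exists_continuousOn_majorant`). The
bounds `τ k` and `B k` are turned into one `𝒦ℒ` function by `exists_isKL_of_steps`. -/

/-! ### Absolutely continuous functions and a Carathéodory integral equation. -/

theorem AbsolutelyContinuousOnInterval.comp_monotone {X : Type*} [PseudoMetricSpace X]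
    {x : ℝ → X} {a b c d : ℝ} {φ : ℝ → ℝ} (hx : AbsolutelyContinuousOnInterval x a b)
    (hmono : Monotone φ) (hlip : ∀ p q, dist (φ p) (φ q) ≤ dist p q)
    (hmaps : MapsTo φ (uIcc c d) (uIcc a b)) :
    AbsolutelyContinuousOnInterval (fun t => x (φ t)) c d := by
  rw [absolutelyContinuousOnInterval_iff] at hx ⊢
  intro ε hε
  obtain ⟨δ, hδ, h⟩ := hx ε hε
  refine ⟨δ, hδ, fun E hE hlen => ?_⟩
  refine h (E.1, fun i => (φ (E.2 i).1, φ (E.2 i).2)) ⟨fun i hi => ?_, fun i hi j hj hij => ?_⟩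
    ((Finset.sum_le_sum fun i _ => hlip _ _).trans_lt hlen)
  · exact ⟨hmaps (hE.1 i hi).1, hmaps (hE.1 i hi).2⟩
  · have := hE.2 hi hj hij
    simp only [Function.onFun, uIoc, Ioc_disjoint_Ioc, ← hmono.map_min, ← hmono.map_max] at this ⊢
    exact hmono this

theorem AbsolutelyContinuousOnInterval.of_dist_le {X Y : Type*} [PseudoMetricSpace X]
    [PseudoMetricSpace Y] {x : ℝ → X} {y : ℝ → Y} {a b : ℝ}
    (hx : AbsolutelyContinuousOnInterval x a b)
    (h : ∀ p ∈ uIcc a b, ∀ q ∈ uIcc a b, dist (y p) (y q) ≤ dist (x p) (x q)) :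
    AbsolutelyContinuousOnInterval y a b := by
  rw [absolutelyContinuousOnInterval_iff] at hx ⊢
  intro ε hε
  obtain ⟨δ, hδ, hx⟩ := hx ε hε
  exact ⟨δ, hδ, fun E hE hlen => (Finset.sum_le_sum fun i hi =>
    h _ (hE.1 i hi).1 _ (hE.1 i hi).2).trans_lt (hx E hE hlen)⟩

theorem AbsolutelyContinuousOnInterval.congr {X : Type*} [PseudoMetricSpace X] {x y : ℝ → X}
    {a b : ℝ} (hx : AbsolutelyContinuousOnInterval x a b) (h : EqOn x y (uIcc a b)) :
    AbsolutelyContinuousOnInterval y a b :=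
  hx.of_dist_le fun p hp q hq => by rw [h hp, h hq]

/-- The increments are dominated by those of the real primitive of `‖g‖`. -/
theorem IntervalIntegrable.absolutelyContinuousOnInterval_integral {E : Type*}
    [NormedAddCommGroup E] [NormedSpace ℝ E] {g : ℝ → E} {a b : ℝ}
    (hg : IntervalIntegrable g volume a b) :
    AbsolutelyContinuousOnInterval (fun t => ∫ τ in a..t, g τ) a b := by
  have hsub : ∀ p ∈ uIcc a b, IntervalIntegrable g volume a p := fun p hp =>
    hg.mono_set (uIcc_subset_uIcc left_mem_uIcc hp)
  refine (hg.norm.absolutelyContinuousOnInterval_intervalIntegral left_mem_uIcc).of_dist_le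
    fun p hp q hq => ?_
  rw [dist_eq_norm, Real.dist_eq, intervalIntegral.integral_interval_sub_left (hsub p hp) (hsub q hq),
    intervalIntegral.integral_interval_sub_left (hsub p hp).norm (hsub q hq).norm]
  exact intervalIntegral.norm_integral_le_abs_integral_norm

/-- A solution of an integral equation with a Carathéodory right-hand side that vanishes at the
origin and is Lipschitz continuous on a ball, for a small initial value. -/
theorem exists_integral_solution {E : Type*} [NormedAddCommGroup E] [NormedSpace ℝ E]
    [CompleteSpace E] {g : ℝ → E → E} {s L ρ : ℝ} (hs : 0 ≤ s) (hL : 0 < L) (hρ : 0 < ρ)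
    (hzero : ∀ t, g t 0 = 0)
    (hlip : ∀ᵐ t ∂volume, t ∈ Icc 0 s → ∀ y y' : E, ‖y‖ ≤ ρ → ‖y'‖ ≤ ρ →
      ‖g t y - g t y'‖ ≤ L * ‖y - y'‖)
    (hmeas : ∀ y : ℝ → E, Continuous y → (∀ t, ‖y t‖ ≤ ρ) →
      AEStronglyMeasurable (fun t => g t (y t)) (volume.restrict (Icc 0 s)))
    {ζ : E} (hζ : ‖ζ‖ ≤ ρ * Real.exp (-(2 * L * s)) / 2) :
    ∃ y : ℝ → E, Continuous y ∧ (∀ t, ‖y t‖ ≤ ρ) ∧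
      IntervalIntegrable (fun t => g t (y t)) volume 0 s ∧
      ∀ t ∈ Icc 0 s, y t = ζ + ∫ τ in (0 : ℝ)..t, g τ (y τ) := by
  -- The fixed point is sought as `y t = exp (2 L t) • w t`. With this weight the integral operator
  -- contracts by `1/2`, since `L ∫₀ᵗ exp (2 L τ) dτ ≤ exp (2 L t) / 2`; the radius `c` for `w`
  -- ensures `‖y‖ ≤ ρ`.
  set c : ℝ := ρ * Real.exp (-(2 * L * s)) with hc
  have hc0 : 0 < c := by positivity
  let ball : Set C(Icc (0 : ℝ) s, E) := Metric.closedBall 0 c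
  have hball : IsComplete ball := Metric.isClosed_closedBall.isComplete
  let lift : C(Icc (0 : ℝ) s, E) → ℝ → E := fun w t =>
    Real.exp (2 * L * projIcc 0 s hs t) • w (projIcc 0 s hs t)
  have lift_cont : ∀ w, Continuous (lift w) := fun w => by
    have h := continuous_projIcc (h := hs)
    exact (Real.continuous_exp.comp (continuous_const.mul (continuous_subtype_val.comp h))).smul
      (w.continuous.comp h)
  have lift_sub : ∀ w w' : C(Icc (0 : ℝ) s, E), ∀ t ∈ Icc (0 : ℝ) s,
      ‖lift w t - lift w' t‖ ≤ Real.exp (2 * L * t) * dist w w' := fun w w' t ht => by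
    simp only [lift, ← smul_sub, norm_smul, projIcc_of_mem hs ht, Real.norm_eq_abs, Real.abs_exp]
    gcongr
    rw [← dist_eq_norm]
    exact ContinuousMap.dist_apply_le_dist _
  have lift_le : ∀ w ∈ ball, ∀ t, ‖lift w t‖ ≤ ρ := fun w hw t => by
    have h1 : ‖w (projIcc 0 s hs t)‖ ≤ c :=
      (w.norm_coe_le_norm _).trans (by simpa [ball] using hw)
    have h2 : Real.exp (2 * L * projIcc 0 s hs t) ≤ Real.exp (2 * L * s) := by
      gcongr; exact (projIcc 0 s hs t).2.2
    calc ‖lift w t‖ = Real.exp (2 * L * projIcc 0 s hs t) * ‖w (projIcc 0 s hs t)‖ := by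
          simp [lift, norm_smul]
      _ ≤ Real.exp (2 * L * s) * c := by gcongr
      _ = ρ := by rw [hc, mul_left_comm, ← Real.exp_add]; simp
  have lift_zero : ∀ t, lift 0 t = 0 := fun t => by simp [lift]
  have zero_mem : (0 : C(Icc (0 : ℝ) s, E)) ∈ ball := by simp [ball, hc0.le]
  have hint : ∀ w ∈ ball, IntervalIntegrable (fun t => g t (lift w t)) volume 0 s := by
    intro w hw
    rw [intervalIntegrable_iff_integrableOn_Icc_of_le hs]
    refine Integrable.of_bound (hmeas _ (lift_cont w) (lift_le w hw)) (L * ρ) ?_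
    rw [ae_restrict_iff' measurableSet_Icc]
    filter_upwards [hlip] with t ht hts
    have := ht hts (lift w t) 0 (lift_le w hw t) (by simpa using hρ.le)
    rw [hzero, sub_zero, sub_zero] at this
    exact this.trans (by gcongr; exact lift_le w hw t)
  have hintt : ∀ w ∈ ball, ∀ t ∈ Icc (0 : ℝ) s,
      IntervalIntegrable (fun t => g t (lift w t)) volume 0 t := fun w hw t ht =>
    (hint w hw).mono_set (by rw [uIcc_of_le hs, uIcc_of_le ht.1]; exact Icc_subset_Icc_right ht.2)
  have hest : ∀ w ∈ ball, ∀ w' ∈ ball, ∀ t ∈ Icc (0 : ℝ) s,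
      ‖(∫ τ in (0 : ℝ)..t, g τ (lift w τ)) - ∫ τ in (0 : ℝ)..t, g τ (lift w' τ)‖ ≤
        Real.exp (2 * L * t) / 2 * dist w w' := by
    intro w hw w' hw' t ht
    rw [← intervalIntegral.integral_sub (hintt w hw t ht) (hintt w' hw' t ht)]
    have hderiv : ∀ τ ∈ uIcc (0 : ℝ) t, HasDerivAt
        (fun τ => Real.exp (2 * L * τ) / 2 * dist w w')
        (L * (Real.exp (2 * L * τ) * dist w w')) τ := fun τ _ => by
      have h1 : HasDerivAt (fun τ : ℝ => 2 * L * τ) (2 * L) τ := by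
        simpa using (hasDerivAt_id τ).const_mul (2 * L)
      refine ((h1.exp.div_const 2).mul_const (dist w w')).congr_deriv ?_
      ring
    have hcont : Continuous fun τ : ℝ => L * (Real.exp (2 * L * τ) * dist w w') := by fun_prop
    have hval := intervalIntegral.integral_eq_sub_of_hasDerivAt hderiv (hcont.intervalIntegrable _ _)
    have hle := intervalIntegral.norm_integral_le_of_norm_le (μ := volume)
      (f := fun τ => g τ (lift w τ) - g τ (lift w' τ)) ht.1 ?_ (hcont.intervalIntegrable 0 t)
    · refine hle.trans ?_
      rw [hval]
      simp only [mul_zero, Real.exp_zero]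
      have : 0 ≤ dist w w' := dist_nonneg
      linarith
    · filter_upwards [hlip] with τ hτ hτt
      have hτs : τ ∈ Icc (0 : ℝ) s := ⟨hτt.1.le, hτt.2.trans ht.2⟩
      refine (hτ hτs _ _ (lift_le w hw τ) (lift_le w' hw' τ)).trans ?_
      gcongr
      exact lift_sub w w' τ hτs
  have hΦcont : ∀ w : ball, Continuous fun t : Icc (0 : ℝ) s =>
      Real.exp (-(2 * L * t)) • (ζ + ∫ τ in (0 : ℝ)..t, g τ (lift w τ)) := fun w => by
    have h1 : ContinuousOn (fun t => ∫ τ in (0 : ℝ)..t, g τ (lift w τ)) (Icc 0 s) := by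
      have := intervalIntegral.continuousOn_primitive_interval' (hint w w.2) left_mem_uIcc
      rwa [uIcc_of_le hs] at this
    have h2 := continuousOn_iff_continuous_domRestrict.1 h1
    exact (by fun_prop : Continuous fun t : Icc (0 : ℝ) s => Real.exp (-(2 * L * t))).smul
      (continuous_const.add h2)
  let Φ₀ : ball → C(Icc (0 : ℝ) s, E) := fun w => ⟨_, hΦcont w⟩
  have hΦdist : ∀ w w' : ball, dist (Φ₀ w) (Φ₀ w') ≤ 1 / 2 * dist (w : C(Icc (0 : ℝ) s, E)) w' := fun w w' => by
    rw [ContinuousMap.dist_le (by positivity)]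
    intro t
    have := hest w w.2 w' w'.2 t t.2
    simp only [Φ₀, ContinuousMap.coe_mk, dist_eq_norm, ← smul_sub, add_sub_add_left_eq_sub,
      norm_smul, Real.norm_eq_abs, Real.abs_exp] at this ⊢
    calc _ ≤ Real.exp (-(2 * L * t)) * (Real.exp (2 * L * t) / 2 * ‖(w - w' : C(Icc (0 : ℝ) s, E))‖) := by
          gcongr
      _ = 1 / 2 * ‖(w - w' : C(Icc (0 : ℝ) s, E))‖ := by
          rw [Real.exp_neg]; field_simp
  have hΦzero : ‖Φ₀ ⟨0, zero_mem⟩‖ ≤ c / 2 := by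
    rw [ContinuousMap.norm_le _ (by positivity)]
    intro t
    have : Real.exp (-(2 * L * t)) ≤ 1 := by
      rw [Real.exp_le_one_iff]; nlinarith [t.2.1, mul_nonneg hL.le t.2.1]
    simp only [Φ₀, ContinuousMap.coe_mk, lift_zero, hzero, intervalIntegral.integral_zero, add_zero,
      norm_smul, Real.norm_eq_abs, Real.abs_exp]
    nlinarith [norm_nonneg ζ]
  -- Half of the radius is used by the initial value `ζ`, the other half by the contraction.
  have hΦball : ∀ w : ball, Φ₀ w ∈ ball := fun w => by
    have h1 := hΦdist w ⟨0, zero_mem⟩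
    have h2 : dist (w : C(Icc (0 : ℝ) s, E)) 0 ≤ c := w.2
    rw [dist_zero_right] at h2
    simp only [ball, Metric.mem_closedBall]
    have h3 := dist_triangle (Φ₀ w) (Φ₀ ⟨0, zero_mem⟩) 0
    rw [dist_zero_right (Φ₀ ⟨0, zero_mem⟩)] at h3
    rw [dist_zero_right (w : C(Icc (0 : ℝ) s, E))] at h1
    linarith
  let Φ : ball → ball := fun w => ⟨Φ₀ w, hΦball w⟩
  have hΦ : ContractingWith (1 / 2) Φ :=
    ⟨by norm_num, LipschitzWith.of_dist_le_mul fun w w' => by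
      simpa using! hΦdist w w'⟩
  have : CompleteSpace ball := hball.completeSpace_coe
  have : Nonempty ball := ⟨⟨0, zero_mem⟩⟩
  obtain ⟨w, hw⟩ : ∃ w, Φ w = w := ⟨_, hΦ.fixedPoint_isFixedPt⟩
  refine ⟨lift w, lift_cont w, lift_le w w.2, hint w w.2, fun t ht => ?_⟩
  have hwt : (w : C(Icc (0 : ℝ) s, E)) ⟨t, ht⟩ =
      Real.exp (-(2 * L * t)) • (ζ + ∫ τ in (0 : ℝ)..t, g τ (lift w τ)) := by
    conv_lhs => rw [← hw]
    rfl
  change Real.exp _ • (w : C(Icc (0 : ℝ) s, E)) _ = _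
  rw [projIcc_of_mem hs ht, hwt, smul_smul, ← Real.exp_add]
  simp

/-! ### Trajectories on compact intervals and continuous dependence on the initial state. -/

section Control

variable {n m : ℕ}

/-- `x` is a trajectory outside `C` on the compact interval `[0,s]`, for the essentially bounded
control `u`. -/
structure IsTrajOn (C : Set (EuclideanSpace ℝ (Fin n))) (U : Set (EuclideanSpace ℝ (Fin m)))
    (f : EuclideanSpace ℝ (Fin n) → EuclideanSpace ℝ (Fin m) → EuclideanSpace ℝ (Fin n))
    (x : ℝ → EuclideanSpace ℝ (Fin n)) (u : ℝ → EuclideanSpace ℝ (Fin m)) (s : ℝ) : Prop where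
  nonneg : 0 ≤ s
  control_mem : ∀ t ∈ Ico 0 s, u t ∈ U
  control_meas : AEStronglyMeasurable u (volume.restrict (Icc 0 s))
  control_bdd : ∃ M : ℝ, ∀ᵐ t ∂volume, t ∈ Icc 0 s → ‖u t‖ ≤ M
  traj_notMem : ∀ t ∈ Icc 0 s, x t ∉ C
  traj_ac : AbsolutelyContinuousOnInterval x 0 s
  ode : ∀ᵐ t ∂volume, t ∈ Ioo 0 s → HasDerivAt x (f (x t) (u t)) t

variable {C : Set (EuclideanSpace ℝ (Fin n))} {U : Set (EuclideanSpace ℝ (Fin m))}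
  {f : EuclideanSpace ℝ (Fin n) → EuclideanSpace ℝ (Fin m) → EuclideanSpace ℝ (Fin n)}
  {x x' : ℝ → EuclideanSpace ℝ (Fin n)} {u u' : ℝ → EuclideanSpace ℝ (Fin m)} {s s' : ℝ}

namespace IsTrajOn

theorem continuousOn (h : IsTrajOn C U f x u s) : ContinuousOn x (Icc 0 s) := by
  have := h.traj_ac.continuousOn
  rwa [uIcc_of_le h.nonneg] at this

theorem mono (h : IsTrajOn C U f x u s) (h0 : 0 ≤ s') (hs : s' ≤ s) : IsTrajOn C U f x u s' where
  nonneg := h0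
  control_mem t ht := h.control_mem t ⟨ht.1, ht.2.trans_le hs⟩
  control_meas := h.control_meas.mono_measure (Measure.restrict_mono (Icc_subset_Icc_right hs) le_rfl)
  control_bdd := by
    obtain ⟨M, hM⟩ := h.control_bdd
    exact ⟨M, hM.mono fun t ht hts => ht ⟨hts.1, hts.2.trans hs⟩⟩
  traj_notMem t ht := h.traj_notMem t ⟨ht.1, ht.2.trans hs⟩
  traj_ac := h.traj_ac.mono (by
    rw [uIcc_of_le h0, uIcc_of_le h.nonneg]; exact Icc_subset_Icc_right hs)
  ode := h.ode.mono fun t ht hts => ht ⟨hts.1, hts.2.trans_le hs⟩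

/-- Controls are compared on `Ico 0 s` only, because in a concatenation the control at the switching
time `s` belongs to the next piece. -/
theorem congr (h : IsTrajOn C U f x u s) (hx : EqOn x x' (Icc 0 s)) (hu : EqOn u u' (Ico 0 s)) :
    IsTrajOn C U f x' u' s := by
  have hs : ∀ᵐ t ∂(volume : Measure ℝ), t ≠ s := by simp [ae_iff, measure_singleton]
  refine ⟨h.nonneg, fun t ht => hu ht ▸ h.control_mem t ht, h.control_meas.congr ?_, ?_,
    fun t ht => hx ht ▸ h.traj_notMem t ht,
    h.traj_ac.congr (by rwa [uIcc_of_le h.nonneg]), ?_⟩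
  · rw [EventuallyEq, ae_restrict_iff' measurableSet_Icc]
    filter_upwards [hs] with t ht hts
    exact hu ⟨hts.1, hts.2.lt_of_ne ht⟩
  · obtain ⟨M, hM⟩ := h.control_bdd
    refine ⟨M, ?_⟩
    filter_upwards [hs, hM] with t ht hM hts
    rw [← hu ⟨hts.1, hts.2.lt_of_ne ht⟩]
    exact hM hts
  · filter_upwards [h.ode] with t ht hts
    rw [← hx (Ioo_subset_Icc_self hts), ← hu (Ioo_subset_Ico_self hts)]
    refine (ht hts).congr_of_eventuallyEq ?_
    filter_upwards [Icc_mem_nhds hts.1 hts.2] with τ hτ using (hx hτ).symm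

theorem append {a b : ℝ} (h₁ : IsTrajOn C U f x u a)
    (h₂ : IsTrajOn C U f (fun t => x (a + t)) (fun t => u (a + t)) b) :
    IsTrajOn C U f x u (a + b) := by
  have ha := h₁.nonneg
  have hb := h₂.nonneg
  have hmp : MeasurePreserving (fun t : ℝ => t - a) volume volume := measurePreserving_sub_right _ a
  have hane : ∀ᵐ t ∂(volume : Measure ℝ), t ≠ a := by simp [ae_iff, measure_singleton]
  refine ⟨add_nonneg ha hb, fun t ht => ?_, ?_, ?_, fun t ht => ?_, ?_, ?_⟩
  · rcases lt_or_ge t a with hta | hta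
    · exact h₁.control_mem t ⟨ht.1, hta⟩
    · simpa using h₂.control_mem (t - a) ⟨by linarith, by linarith [ht.2]⟩
  · have hmeas : AEStronglyMeasurable u (volume.restrict (Icc a (a + b))) := by
      have hpre : (fun t : ℝ => t - a) ⁻¹' Icc 0 b = Icc a (a + b) := by
        ext t; simp [add_comm]
      have := h₂.control_meas.comp_measurePreserving (hmp.restrict_preimage (s := Icc 0 b) measurableSet_Icc)
      rw [hpre] at this
      simpa [Function.comp_def] using this
    rw [← Icc_union_Icc_eq_Icc ha (by linarith : a ≤ a + b)]
    exact aestronglyMeasurable_union_iff.2 ⟨h₁.control_meas, hmeas⟩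
  · obtain ⟨M₁, hM₁⟩ := h₁.control_bdd
    obtain ⟨M₂, hM₂⟩ := h₂.control_bdd
    refine ⟨max M₁ M₂, ?_⟩
    filter_upwards [hM₁, hmp.quasiMeasurePreserving.ae hM₂] with t h1 h2 ht
    rcases le_or_gt t a with hta | hta
    · exact (h1 ⟨ht.1, hta⟩).trans (le_max_left _ _)
    · have := h2 ⟨by linarith, by linarith [ht.2]⟩
      rw [add_sub_cancel] at this
      exact this.trans (le_max_right _ _)
  · rcases le_or_gt t a with hta | hta
    · exact h₁.traj_notMem t ⟨ht.1, hta⟩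
    · simpa using h₂.traj_notMem (t - a) ⟨by linarith, by linarith [ht.2]⟩
  -- Clamping time writes `x t` as `x (min t a) + x (a + max (t - a) 0) - x a`, a combination of
  -- functions absolutely continuous on the whole interval.
  · have c₁ : AbsolutelyContinuousOnInterval (fun t => x (min t a)) 0 (a + b) := by
      refine h₁.traj_ac.comp_monotone (fun p q hpq => min_le_min_right _ hpq) (fun p q => ?_) ?_
      · have := abs_min_sub_min_le_max p a q a
        rw [Real.dist_eq, Real.dist_eq]
        simpa using this
      · intro t ht
        rw [uIcc_of_le (by linarith)] at ht
        rw [uIcc_of_le ha]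
        exact ⟨le_min ht.1 ha, min_le_right _ _⟩
    have c₂ : AbsolutelyContinuousOnInterval (fun t => x (a + max (t - a) 0)) 0 (a + b) := by
      refine h₂.traj_ac.comp_monotone (φ := fun t => max (t - a) 0)
        (fun p q hpq => max_le_max_right _ (by linarith)) (fun p q => ?_) ?_
      · have := abs_max_sub_max_le_max (p - a) 0 (q - a) 0
        rw [Real.dist_eq, Real.dist_eq]
        simpa using this
      · intro t ht
        rw [uIcc_of_le (by linarith)] at ht
        rw [uIcc_of_le hb]
        exact ⟨le_max_right _ _, max_le (by linarith [ht.2]) hb⟩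
    have c₃ : AbsolutelyContinuousOnInterval (fun _ : ℝ => x a) 0 (a + b) :=
      ((LipschitzWith.const (x a)).lipschitzOnWith).absolutelyContinuousOnInterval
    refine ((c₁.add c₂).sub c₃).congr fun t _ => ?_
    rcases le_total t a with hta | hta
    · simp [hta]
    · simp [hta]
  · filter_upwards [h₁.ode, hmp.quasiMeasurePreserving.ae h₂.ode, hane] with t h1 h2 hta ht
    rcases hta.lt_or_gt with hta | hta
    · exact h1 ⟨ht.1, hta⟩
    · have := h2 ⟨by linarith, by linarith [ht.2]⟩
      rw [add_sub_cancel] at this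
      simpa [Function.comp_def] using this.comp_sub_const t a

end IsTrajOn

/-- Continuous dependence on the initial state, with the same control. -/
theorem IsTrajOn.exists_perturbed (hC : IsClosed C) (hU : IsClosed U) (hf : HypHl C U f)
    (h : IsTrajOn C U f x u s) {ε : ℝ} (hε : 0 < ε) :
    ∃ δ > 0, ∀ z, dist z (x 0) < δ →
      ∃ x', IsTrajOn C U f x' u s ∧ x' 0 = z ∧ ∀ t ∈ Icc 0 s, dist (x' t) (x t) ≤ ε := by
  have hs := h.nonneg
  have hane : ∀ᵐ t ∂(volume : Measure ℝ), t ≠ s := by simp [ae_iff, measure_singleton]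
  have hK₀ : IsCompact (x '' Icc 0 s) := isCompact_Icc.image_of_continuousOn h.continuousOn
  obtain ⟨ρ₀, hρ₀, hρ₀C⟩ := hK₀.exists_cthickening_subset_open hC.isOpen_compl
    (by rintro _ ⟨t, ht, rfl⟩; exact h.traj_notMem t ht)
  -- A deviation of at most `ρ` from `x` stays in a compact set disjoint from `C`, where the
  -- Lipschitz bound holds, and within `ε`.
  set ρ := min ρ₀ ε with hρdef
  have hρ : 0 < ρ := lt_min hρ₀ hε
  set K := Metric.cthickening ρ₀ (x '' Icc 0 s) with hKdef
  have hK : IsCompact K := hK₀.cthickening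
  have hxK : ∀ t ∈ Icc 0 s, ∀ y, ‖y‖ ≤ ρ → x t + y ∈ K := fun t ht y hy =>
    Metric.mem_cthickening_of_dist_le _ (x t) _ _ (mem_image_of_mem x ht)
      (by simpa using hy.trans (min_le_left _ _))
  obtain ⟨M, hM⟩ := h.control_bdd
  have hU₁ : IsCompact (U ∩ Metric.closedBall 0 M) := (isCompact_closedBall 0 M).inter_left hU
  obtain ⟨L, hL, hlip⟩ := hf.lipschitz K hK hρ₀C _ hU₁ inter_subset_left
  have hUae : ∀ᵐ t ∂volume, t ∈ Icc 0 s → u t ∈ U ∩ Metric.closedBall 0 M := by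
    filter_upwards [hM, hane] with t ht hts hts'
    exact ⟨h.control_mem t ⟨hts'.1, hts'.2.lt_of_ne hts⟩, by simpa using ht hts'⟩
  -- Continuity of `f` is known on `Cᶜ ×ˢ U` only; its extension by zero is Borel measurable.
  have hfmeas : ∀ y : ℝ → EuclideanSpace ℝ (Fin n), ContinuousOn y (Icc 0 s) →
      (∀ t ∈ Icc 0 s, y t ∈ K) →
      AEStronglyMeasurable (fun t => f (y t) (u t)) (volume.restrict (Icc 0 s)) := by
    classical
    intro y hy hyK
    have hmS : MeasurableSet (Cᶜ ×ˢ U) := hC.measurableSet.compl.prod hU.measurableSet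
    have hF := hf.continuousOn.measurable_piecewise
      (g := fun _ => (0 : EuclideanSpace ℝ (Fin n))) continuousOn_const hmS
    have hp : AEMeasurable (fun t => (y t, u t)) (volume.restrict (Icc 0 s)) :=
      (hy.aemeasurable measurableSet_Icc).prodMk h.control_meas.aemeasurable
    refine ((hF.comp_aemeasurable hp).congr ?_).aestronglyMeasurable
    rw [EventuallyEq, ae_restrict_iff' measurableSet_Icc]
    filter_upwards [hUae] with t htU ht
    simp only [Function.comp_apply]
    exact piecewise_eq_of_mem _ _ _
      (show (y t, u t) ∈ Cᶜ ×ˢ U from ⟨hρ₀C (hyK t ht), (htU ht).1⟩)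
  refine ⟨ρ * Real.exp (-(2 * L * s)) / 2, by positivity, fun z hz => ?_⟩
  -- The unknown is the deviation `y = x' - x`, whose equation has a right-hand side vanishing at `y
  -- = 0`.
  obtain ⟨y, hyc, hyρ, hyi, hy⟩ := exists_integral_solution (s := s) (L := L) (ρ := ρ)
    (g := fun t y => f (x t + y) (u t) - f (x t) (u t)) (ζ := z - x 0) hs hL hρ (by simp)
    (by
      filter_upwards [hUae] with t htU ht y y' hy hy'
      have := hlip _ (hxK t ht y hy) _ (hxK t ht y' hy') _ (htU ht)
      simpa using this)
    (fun y hyc hyρ => (hfmeas _ (h.continuousOn.add hyc.continuousOn)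
      fun t ht => hxK t ht _ (hyρ t)).sub (hfmeas _ h.continuousOn fun t ht => by
        simpa using hxK t ht 0 (by simpa using hρ.le)))
    (by rw [← dist_eq_norm]; exact hz.le)
  have h0 : (0 : ℝ) ∈ Icc 0 s := ⟨le_rfl, hs⟩
  refine ⟨fun t => x t + y t, ⟨hs, h.control_mem, h.control_meas, h.control_bdd,
    fun t ht => hρ₀C (hxK t ht _ (hyρ t)), ?_, ?_⟩, ?_, fun t ht => ?_⟩
  · have h1 := hyi.absolutelyContinuousOnInterval_integral
    have h2 : AbsolutelyContinuousOnInterval (fun _ : ℝ => z - x 0) 0 s :=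
      ((LipschitzWith.const (z - x 0)).lipschitzOnWith).absolutelyContinuousOnInterval
    refine (h.traj_ac.add (h2.add h1)).congr fun t ht => ?_
    rw [uIcc_of_le hs] at ht
    simp [hy t ht]
  · filter_upwards [h.ode, hyi.ae_hasDerivAt_integral] with t h1 h2 ht
    rw [uIcc_of_le hs] at h2
    have h3 := (h1 ht).add ((h2 (Ioo_subset_Icc_self ht) 0 h0).const_add (z - x 0))
    rw [add_sub_cancel] at h3
    refine h3.congr_of_eventuallyEq ?_
    filter_upwards [Icc_mem_nhds ht.1 ht.2] with τ hτ
    simp [hy τ hτ]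
  · simp [hy 0 h0]
  · rw [dist_eq_norm, add_sub_cancel_left]
    exact (hyρ t).trans (min_le_right _ _)

end Control

/-! ### Halving the distance, uniformly on a shell. -/

theorem ContinuousOn.exists_first_hitting {g : ℝ → ℝ} {s c : ℝ} (hs : 0 ≤ s)
    (hg : ContinuousOn g (Icc 0 s)) (h0 : c < g 0) (h1 : g s ≤ c) :
    ∃ s' ∈ Ioc 0 s, g s' = c ∧ ∀ t ∈ Icc 0 s', c ≤ g t := by
  have hA : IsCompact (Icc 0 s ∩ g ⁻¹' Iic c) :=
    isCompact_Icc.of_isClosed_subset (hg.preimage_isClosed_of_isClosed isClosed_Icc isClosed_Iic)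
      inter_subset_left
  obtain ⟨s', ⟨hs's, hgs'⟩, hleast⟩ := hA.exists_isLeast ⟨s, ⟨hs, le_rfl⟩, h1⟩
  obtain ⟨t, ht, htc⟩ := intermediate_value_Icc' hs's.1
    (hg.mono (Icc_subset_Icc_right hs's.2)) ⟨hgs', h0.le⟩
  have hts' : t = s' := le_antisymm ht.2 (hleast ⟨⟨ht.1, ht.2.trans hs's.2⟩, htc.le⟩)
  subst hts'
  refine ⟨t, ⟨hs's.1.lt_of_ne ?_, hs's.2⟩, htc, fun τ hτ => ?_⟩
  · rintro rfl
    exact h0.ne' htc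
  · by_contra! hlt
    have := hleast ⟨⟨hτ.1, hτ.2.trans hs's.2⟩, hlt.le⟩
    have : τ = t := le_antisymm hτ.2 this
    subst this
    exact hlt.ne htc

section Control

variable {n m : ℕ} {C : Set (EuclideanSpace ℝ (Fin n))} {U : Set (EuclideanSpace ℝ (Fin m))}
  {f : EuclideanSpace ℝ (Fin n) → EuclideanSpace ℝ (Fin m) → EuclideanSpace ℝ (Fin n)}
  {x x' : ℝ → EuclideanSpace ℝ (Fin n)} {u u' : ℝ → EuclideanSpace ℝ (Fin m)} {s s' : ℝ}

theorem continuous_targetDist (C : Set (EuclideanSpace ℝ (Fin n))) : Continuous (targetDist C) :=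
  Metric.continuous_infDist_pt C

theorem targetDist_nonneg (z : EuclideanSpace ℝ (Fin n)) : 0 ≤ targetDist C z :=
  Metric.infDist_nonneg

theorem targetDist_pos_iff (hC : IsClosed C) (hne : C.Nonempty) {z : EuclideanSpace ℝ (Fin n)} :
    0 < targetDist C z ↔ z ∉ C :=
  (hC.notMem_iff_infDist_pos hne).symm

/-- A point outside `C` has a nearest point on the frontier, which is bounded; `C` itself may be
unbounded. -/
theorem isBounded_targetDist_le (hne : C.Nonempty) (hfr : IsCompact (frontier C)) (b : ℝ) :
    Bornology.IsBounded {z | z ∉ C ∧ targetDist C z ≤ b} := by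
  refine (hfr.isBounded.cthickening (δ := b)).subset fun z hz => ?_
  obtain ⟨y, hy, hzy⟩ := exists_mem_frontier_infDist_compl_eq_dist (s := Cᶜ) hz.1
    (by simpa [nonempty_iff_ne_empty] using hne)
  rw [frontier_compl] at hy
  rw [compl_compl] at hzy
  exact Metric.mem_cthickening_of_dist_le _ _ _ _ hy (hzy ▸ hz.2)

theorem isCompact_shell (hC : IsClosed C) (hne : C.Nonempty) (hfr : IsCompact (frontier C))
    {a : ℝ} (ha : 0 < a) (b : ℝ) : IsCompact {z | a ≤ targetDist C z ∧ targetDist C z ≤ b} := by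
  refine Metric.isCompact_of_isClosed_isBounded ?_
    ((isBounded_targetDist_le hne hfr b).subset fun z hz =>
      ⟨(targetDist_pos_iff hC hne).1 (ha.trans_le hz.1), hz.2⟩)
  exact (isClosed_le continuous_const (continuous_targetDist C)).inter
    (isClosed_le (continuous_targetDist C) continuous_const)

theorem IsAdmissiblePair.isTrajOn {T : EReal} (h : IsAdmissiblePair C U f x u T)
    (hs : s ∈ timeInterval T) : IsTrajOn C U f x u s := by
  have hsub : ∀ t ∈ Icc 0 s, t ∈ timeInterval T := fun t ht =>
    ⟨ht.1, (EReal.coe_le_coe_iff.2 ht.2).trans_lt hs.2⟩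
  refine ⟨hs.1, fun t ht => h.control_mem t (hsub t (Ico_subset_Icc_self ht)),
    (h.control_memLp s hs).1, ?_, fun t ht => h.traj_notMem t (hsub t ht), h.traj_ac s hs,
    h.ode.mono fun t ht hts => ht (hsub t (Ioo_subset_Icc_self hts))⟩
  have hlt := (h.control_memLp s hs).2
  rw [eLpNorm_exponent_top] at hlt
  refine ⟨(eLpNormEssSup u (volume.restrict (Icc 0 s))).toReal, ?_⟩
  have := enorm_ae_le_eLpNormEssSup u (volume.restrict (Icc 0 s))
  rw [ae_restrict_iff' measurableSet_Icc] at this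
  filter_upwards [this] with t ht hts
  simpa using ENNReal.toReal_mono hlt.ne (ht hts)

/-- The decay bound decides only when `T = ⊤`. For finite `T` it could become small only after `T`,
and `reaches` is used instead. -/
theorem IsAdmissiblePair.exists_targetDist_lt {T : EReal} (h : IsAdmissiblePair C U f x u T)
    {b : ℝ → ℝ} (hb : ∀ t, 0 ≤ t → targetDist C (x t) ≤ b t) (hb0 : Tendsto b atTop (𝓝 0))
    {ε : ℝ} (hε : 0 < ε) : ∃ s ∈ timeInterval T, targetDist C (x s) < ε := by
  have hT := h.time_pos
  induction T with
  | bot => exact absurd hT (by simp)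
  | coe S =>
    have hS : 0 < S := by exact_mod_cast hT
    have h1 := (h.reaches S rfl).eventually (gt_mem_nhds hε)
    have h2 : ∀ᶠ t in 𝓝[<] S, t ∈ Ioo 0 S := Ioo_mem_nhdsLT hS
    obtain ⟨t, ht, ht'⟩ := (h1.and h2).exists
    exact ⟨t, ⟨ht'.1.le, by exact_mod_cast ht'.2⟩, ht⟩
  | top =>
    obtain ⟨t, ht, ht'⟩ := ((hb0.eventually (gt_mem_nhds hε)).and (eventually_ge_atTop 0)).exists
    exact ⟨t, ⟨ht', EReal.coe_lt_top t⟩, (hb t ht').trans_lt ht⟩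

/-- From every point of a shell around the target, the distance from the target can be halved within
a uniform time, by uniformly bounded controls, and with a uniform overshoot. -/
theorem exists_halving_steps (hC : IsClosed C) (hne : C.Nonempty) (hfr : IsCompact (frontier C))
    (hU : IsClosed U) (hf : HypHl C U f) {β : ℝ → ℝ → ℝ} (hβ : IsKL β)
    (hgac : ∀ z, z ∉ C → ∃ x u T, IsAdmissiblePair C U f x u T ∧ x 0 = z ∧
      ∀ t, 0 ≤ t → targetDist C (x t) ≤ β (targetDist C z) t)
    {r : ℝ} (hr : 0 < r) :
    ∃ M τ : ℝ, 1 ≤ τ ∧ ∀ z, r / 2 < targetDist C z → targetDist C z ≤ r →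
      ∃ x u s, IsTrajOn C U f x u s ∧ x 0 = z ∧ 0 < s ∧ s ≤ τ ∧ targetDist C (x s) = r / 2 ∧
        (∀ t ∈ Icc 0 s, r / 2 ≤ targetDist C (x t) ∧ targetDist C (x t) ≤ β r 0 + r) ∧
        ∀ᵐ t ∂volume, t ∈ Icc 0 s → ‖u t‖ ≤ M := by
  suffices H : ∃ M τ : ℝ, ∀ z ∈ {z | r / 2 ≤ targetDist C z ∧ targetDist C z ≤ r},
      r / 2 < targetDist C z →
      ∃ x u s, IsTrajOn C U f x u s ∧ x 0 = z ∧ 0 < s ∧ s ≤ τ ∧ targetDist C (x s) = r / 2 ∧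
        (∀ t ∈ Icc 0 s, r / 2 ≤ targetDist C (x t) ∧ targetDist C (x t) ≤ β r 0 + r) ∧
        ∀ᵐ t ∂volume, t ∈ Icc 0 s → ‖u t‖ ≤ M by
    obtain ⟨M, τ, H⟩ := H
    -- `τ` is only an upper bound for durations; keeping it at least `1` makes its partial sums
    -- diverge, as the `𝒦ℒ` estimate requires.
    refine ⟨M, max τ 1, le_max_right _ _, fun z hz hzr => ?_⟩
    obtain ⟨x, u, s, h1, h2, h3, h4, h5⟩ := H z ⟨hz.le, hzr⟩ hz
    exact ⟨x, u, s, h1, h2, h3, h4.trans (le_max_left _ _), h5⟩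
  -- Having uniform `M` and `τ` passes to subsets and to unions (by maxima), so by compactness it is
  -- enough to have it near each point.
  refine (isCompact_shell hC hne hfr (half_pos hr) r).induction_on ⟨0, 0, by simp⟩ ?_ ?_ ?_
  · rintro A B hAB ⟨M, τ, H⟩
    exact ⟨M, τ, fun z hz => H z (hAB hz)⟩
  · rintro A B ⟨M, τ, H⟩ ⟨M', τ', H'⟩
    refine ⟨max M M', max τ τ', fun z hz hzr => ?_⟩
    rcases hz with hz | hz
    · obtain ⟨x, u, s, h1, h2, h3, h4, h5, h6, h7⟩ := H z hz hzr
      exact ⟨x, u, s, h1, h2, h3, h4.trans (le_max_left _ _), h5, h6,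
        h7.mono fun t ht hts => (ht hts).trans (le_max_left _ _)⟩
    · obtain ⟨x, u, s, h1, h2, h3, h4, h5, h6, h7⟩ := H' z hz hzr
      exact ⟨x, u, s, h1, h2, h3, h4.trans (le_max_right _ _), h5, h6,
        h7.mono fun t ht hts => (ht hts).trans (le_max_right _ _)⟩
  · rintro z₀ ⟨hz₀, hz₀r⟩
    have hz₀C : z₀ ∉ C := (targetDist_pos_iff hC hne).1 ((half_pos hr).trans_le hz₀)
    obtain ⟨x, u, T, hadm, hx0, hdecay⟩ := hgac z₀ hz₀C
    obtain ⟨s, hsT, hds⟩ := hadm.exists_targetDist_lt hdecay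
      (hβ.tendsto_zero _ (targetDist_nonneg z₀)) (by positivity : 0 < r / 4)
    have htraj := hadm.isTrajOn hsT
    obtain ⟨M, hM⟩ := htraj.control_bdd
    -- The reference trajectory ends below `r/4`, so a perturbation of size at most `r/4` ends below
    -- `r/2` and has crossed that level.
    obtain ⟨δ, hδ, hpert⟩ := htraj.exists_perturbed hC hU hf (by positivity : 0 < r / 4)
    refine ⟨Metric.ball z₀ δ, mem_nhdsWithin_of_mem_nhds (Metric.ball_mem_nhds _ hδ), M, s,
      fun z hz hzr => ?_⟩
    obtain ⟨y, hy, hy0, hyx⟩ := hpert z (by rw [hx0]; exact hz)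
    have hdist : ∀ t ∈ Icc 0 s, targetDist C (y t) ≤ targetDist C (x t) + r / 4 := fun t ht =>
      (Metric.infDist_le_infDist_add_dist (y := x t)).trans (add_le_add le_rfl (hyx t ht))
    have hx_le : ∀ t, 0 ≤ t → targetDist C (x t) ≤ β r 0 := fun t ht => by
      refine (hdecay t ht).trans (((hβ.strictMonoOn t ht).monotoneOn
        (targetDist_nonneg z₀) hr.le hz₀r).trans ?_)
      exact (hβ.strictAntiOn r hr).antitoneOn (mem_Ici.2 le_rfl) (mem_Ici.2 ht) ht
    obtain ⟨s', hs', hys', hlow⟩ := ContinuousOn.exists_first_hitting htraj.nonneg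
      ((continuous_targetDist C).comp_continuousOn hy.continuousOn) (c := r / 2)
      (by simpa [hy0] using hzr)
      (by
        have := hdist s ⟨htraj.nonneg, le_rfl⟩
        simp only [Function.comp_apply]
        linarith)
    refine ⟨y, u, s', hy.mono hs'.1.le hs'.2, hy0, hs'.1, hs'.2, hys',
      fun t ht => ⟨hlow t ht, ?_⟩, hM.mono fun t ht hts => ht ⟨hts.1, hts.2.trans hs'.2⟩⟩
    have := hdist t ⟨ht.1, ht.2.trans hs'.2⟩
    have := hx_le t ht.1
    linarith

end Control

/-! ### Concatenation of infinitely many steps. -/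

theorem exists_mem_Ico_succ_of_lt {S : ℕ → ℝ} (hS0 : S 0 = 0) {t : ℝ} (ht : 0 ≤ t)
    {N : ℕ} (hN : t < S N) : ∃ j, t ∈ Ico (S j) (S (j + 1)) := by
  classical
  have hex : ∃ j, t < S (j + 1) := by
    cases N with
    | zero => exact absurd hN (by rw [hS0]; exact not_lt.2 ht)
    | succ N => exact ⟨N, hN⟩
  refine ⟨Nat.find hex, ?_, Nat.find_spec hex⟩
  rcases hj : Nat.find hex with _ | j
  · rwa [hS0]
  · exact not_lt.1 (Nat.find_min hex (by omega))

section Control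

variable {n m : ℕ} {C : Set (EuclideanSpace ℝ (Fin n))} {U : Set (EuclideanSpace ℝ (Fin m))}
  {f : EuclideanSpace ℝ (Fin n) → EuclideanSpace ℝ (Fin m) → EuclideanSpace ℝ (Fin n)}

/-- Concatenation of a sequence of trajectories. -/
theorem exists_concatenation {X : ℕ → ℝ → EuclideanSpace ℝ (Fin n)}
    {V : ℕ → ℝ → EuclideanSpace ℝ (Fin m)} {s : ℕ → ℝ} (hs : ∀ j, 0 < s j)
    (h : ∀ j, IsTrajOn C U f (X j) (V j) (s j)) (hglue : ∀ j, X j (s j) = X (j + 1) 0) :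
    ∃ x u, (∀ j, IsTrajOn C U f x u (∑ i ∈ Finset.range j, s i)) ∧
      (∀ j, ∀ t ∈ Icc 0 (s j), x (∑ i ∈ Finset.range j, s i + t) = X j t) ∧
      ∀ j, ∀ t ∈ Ico 0 (s j), u (∑ i ∈ Finset.range j, s i + t) = V j t := by
  set S : ℕ → ℝ := fun j => ∑ i ∈ Finset.range j, s i with hS
  have hSsucc : ∀ j, S (j + 1) = S j + s j := fun j => Finset.sum_range_succ _ _
  have hSmono : StrictMono S := strictMono_nat_of_lt_succ fun j => by
    rw [hSsucc]; linarith [hs j]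
  -- A switching time belongs to the later piece. Beyond all `S j` the set is empty and the value
  -- `0` is irrelevant.
  let idx : ℝ → ℕ := fun t => sInf {j | t < S (j + 1)}
  have hidx : ∀ j, ∀ t ∈ Ico 0 (s j), idx (S j + t) = j := fun j t ht => by
    have hmem : j ∈ {i | S j + t < S (i + 1)} := by
      simp only [mem_ofPred_eq, hSsucc]; linarith [ht.2]
    refine le_antisymm (Nat.sInf_le hmem) (le_csInf ⟨j, hmem⟩ fun i hi => ?_)
    have : S j < S (i + 1) := lt_of_le_of_lt (by linarith [ht.1]) hi
    exact Nat.lt_succ_iff.1 (hSmono.lt_iff_lt.1 this)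
  let x : ℝ → EuclideanSpace ℝ (Fin n) := fun t => X (idx t) (t - S (idx t))
  let u : ℝ → EuclideanSpace ℝ (Fin m) := fun t => V (idx t) (t - S (idx t))
  have hx' : ∀ j, ∀ t ∈ Ico 0 (s j), x (S j + t) = X j t := fun j t ht => by
    simp only [x, hidx j t ht, add_sub_cancel_left]
  have hu : ∀ j, ∀ t ∈ Ico 0 (s j), u (S j + t) = V j t := fun j t ht => by
    simp only [u, hidx j t ht, add_sub_cancel_left]
  have hx : ∀ j, ∀ t ∈ Icc 0 (s j), x (S j + t) = X j t := fun j t ht => by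
    rcases ht.2.lt_or_eq with hlt | rfl
    · exact hx' j t ⟨ht.1, hlt⟩
    · rw [← hSsucc, hglue, ← hx' (j + 1) 0 ⟨le_rfl, hs _⟩, add_zero]
  refine ⟨x, u, fun j => ?_, hx, hu⟩
  change IsTrajOn C U f x u (S j)
  induction j with
  | zero =>
    have h0 : S 0 = 0 := rfl
    rw [h0]
    refine ((h 0).mono le_rfl (hs 0).le).congr (fun t ht => ?_) fun t ht => ?_
    · rw [← hx 0 t ⟨ht.1, ht.2.trans (hs 0).le⟩, h0, zero_add]
    · exact absurd ht.2 (not_lt.2 ht.1)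
  | succ j ih =>
    rw [hSsucc]
    exact ih.append ((h j).congr (fun t ht => (hx j t ht).symm) fun t ht => (hu j t ht).symm)

/-- A bounded sequence of states has a convergent subsequence. Its limit is at distance zero from
`C` and is approached from outside, hence lies on the frontier. -/
theorem exists_terminalPoint (hC : IsClosed C) (hne : C.Nonempty) (hfr : IsCompact (frontier C))
    {x : ℝ → EuclideanSpace ℝ (Fin n)} {S : ℕ → ℝ} {T b : ℝ} (hS : Monotone S) (hS0 : ∀ j, 0 ≤ S j)
    (hST : ∀ j, S j < T) (hSlim : Tendsto S atTop (𝓝 T)) (hx : ∀ j, x (S j) ∉ C)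
    (hb : ∀ j, targetDist C (x (S j)) ≤ b)
    (hd : Tendsto (fun j => targetDist C (x (S j))) atTop (𝓝 0)) :
    (terminalPoints C x T).Nonempty := by
  obtain ⟨ζ, -, φ, hφ, hζ⟩ := tendsto_subseq_of_bounded (isBounded_targetDist_le hne hfr b)
    (x := fun j => x (S j)) fun j => ⟨hx j, hb j⟩
  have hζC : ζ ∈ C := by
    rw [hC.mem_iff_infDist_zero hne]
    exact tendsto_nhds_unique (((continuous_targetDist C).tendsto ζ).comp hζ)
      (hd.comp hφ.tendsto_atTop)
  refine ⟨ζ, ?_, S ∘ φ, hS.comp hφ.monotone, fun i => ⟨hS0 _, hST _⟩,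
    hSlim.comp hφ.tendsto_atTop, hζ⟩
  rw [frontier_eq_closure_inter_closure]
  exact ⟨subset_closure hζC, mem_closure_of_tendsto hζ (Eventually.of_forall fun j => hx _)⟩

/-- Concatenation of steps which halve the distance from the target, with bounds on the distance
and the control that depend on the current step. -/
theorem exists_admissible_of_halving_steps (hC : IsClosed C) (hne : C.Nonempty)
    (hfr : IsCompact (frontier C)) {M τ B : ℤ → ℝ} (hB : Tendsto B atTop (𝓝 0))
    (hstep : ∀ (k : ℤ) (z : EuclideanSpace ℝ (Fin n)),
      (2 : ℝ) ^ (-(k + 1)) < targetDist C z → targetDist C z ≤ 2 ^ (-k) →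
      ∃ x u s, IsTrajOn C U f x u s ∧ x 0 = z ∧ 0 < s ∧ s ≤ τ k ∧
        targetDist C (x s) = 2 ^ (-(k + 1)) ∧
        (∀ t ∈ Icc 0 s, 2 ^ (-(k + 1)) ≤ targetDist C (x t) ∧ targetDist C (x t) ≤ B k) ∧
        ∀ᵐ t ∂volume, t ∈ Icc 0 s → ‖u t‖ ≤ M k)
    {z : EuclideanSpace ℝ (Fin n)} {k : ℤ} (hkz : (2 : ℝ) ^ (-(k + 1)) < targetDist C z)
    (hzk : targetDist C z ≤ 2 ^ (-k)) :
    ∃ x u T, IsAdmissiblePair C U f x u T ∧ x 0 = z ∧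
      (∀ t ∈ timeInterval T, ∃ j : ℕ, targetDist C (x t) ≤ B (k + j) ∧
        t < ∑ i ∈ Finset.range (j + 1), τ (k + i)) ∧
      (∀ᵐ t ∂volume, t ∈ timeInterval T → ∃ j : ℕ, 2 ^ (-(k + j + 1)) ≤ targetDist C (x t) ∧
        targetDist C (x t) ≤ B (k + j) ∧ ‖u t‖ ≤ M (k + j)) ∧
      ∀ t, 0 ≤ t → t ∉ timeInterval T → targetDist C (x t) = 0 := by
  -- With the inequalities inside the existentials, the chosen step depends on `k` and `z` alone and
  -- can be iterated.
  have hstep' : ∀ (k : ℤ) (z : EuclideanSpace ℝ (Fin n)), ∃ x u s,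
      (2 : ℝ) ^ (-(k + 1)) < targetDist C z → targetDist C z ≤ 2 ^ (-k) →
      IsTrajOn C U f x u s ∧ x 0 = z ∧ 0 < s ∧ s ≤ τ k ∧
        targetDist C (x s) = 2 ^ (-(k + 1)) ∧
        (∀ t ∈ Icc 0 s, 2 ^ (-(k + 1)) ≤ targetDist C (x t) ∧ targetDist C (x t) ≤ B k) ∧
        ∀ᵐ t ∂volume, t ∈ Icc 0 s → ‖u t‖ ≤ M k := fun k z => by
    by_cases h : (2 : ℝ) ^ (-(k + 1)) < targetDist C z ∧ targetDist C z ≤ 2 ^ (-k)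
    · obtain ⟨x, u, s, hxus⟩ := hstep k z h.1 h.2
      exact ⟨x, u, s, fun _ _ => hxus⟩
    · exact ⟨0, 0, 0, fun h1 h2 => absurd ⟨h1, h2⟩ h⟩
  choose X V s h using hstep'
  let zs : ℕ → EuclideanSpace ℝ (Fin n) := fun j =>
    Nat.rec z (fun j w => X (k + j) w (s (k + j) w)) j
  have hzs : ∀ j : ℕ, (2 : ℝ) ^ (-(k + j + 1)) < targetDist C (zs j) ∧
      targetDist C (zs j) ≤ 2 ^ (-(k + j)) := fun j => by
    induction j with
    | zero =>
      rw [Nat.cast_zero, add_zero]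
      exact ⟨hkz, hzk⟩
    | succ j ih =>
      have hval : targetDist C (zs (j + 1)) = 2 ^ (-(k + j + 1)) := (h _ _ ih.1 ih.2).2.2.2.2.1
      rw [hval]
      push_cast
      rw [← add_assoc]
      exact ⟨zpow_lt_zpow_right₀ (by norm_num) (by omega), le_rfl⟩
  have hp := fun j : ℕ => h (k + j) (zs j) (hzs j).1 (hzs j).2
  set σ : ℕ → ℝ := fun j => s (k + j) (zs j) with hσ
  obtain ⟨x, u, htraj, hx, hu⟩ := exists_concatenation (X := fun j => X (k + j) (zs j))
    (V := fun j => V (k + j) (zs j)) (s := σ) (fun j => (hp j).2.2.1) (fun j => (hp j).1)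
    fun j => (hp (j + 1)).2.1.symm
  set S : ℕ → ℝ := fun j => ∑ i ∈ Finset.range j, σ i with hS
  have hσpos : ∀ j, 0 < σ j := fun j => (hp j).2.2.1
  have hS0 : S 0 = 0 := rfl
  have hSsucc : ∀ j, S (j + 1) = S j + σ j := fun j => Finset.sum_range_succ _ _
  have hSmono : StrictMono S := strictMono_nat_of_lt_succ fun j => by
    rw [hSsucc]; linarith [hσpos j]
  have hSnonneg : ∀ j, 0 ≤ S j := fun j => hS0 ▸ hSmono.monotone (Nat.zero_le j)
  set T : EReal := ⨆ j, (S j : EReal) with hT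
  have hST : ∀ j, (S j : EReal) < T := fun j =>
    (EReal.coe_lt_coe_iff.2 (hSmono (Nat.lt_succ_self j))).trans_le
      (le_iSup (fun j => (S j : EReal)) (j + 1))
  have hxS : ∀ j, x (S j) = zs j := fun j => by
    rw [← (hp j).2.1, ← hx j 0 ⟨le_rfl, (hσpos j).le⟩, add_zero]
  have hfind : ∀ t ∈ timeInterval T, ∃ j, t ∈ Ico (S j) (S (j + 1)) := fun t ht => by
    obtain ⟨N, hN⟩ := lt_iSup_iff.1 ht.2
    exact exists_mem_Ico_succ_of_lt hS0 ht.1 (EReal.coe_lt_coe_iff.1 hN)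
  have hdist : ∀ j, ∀ t ∈ Ico (S j) (S (j + 1)), 2 ^ (-(k + j + 1)) ≤ targetDist C (x t) ∧
      targetDist C (x t) ≤ B (k + j) := fun j t ht => by
    have htj : t - S j ∈ Icc 0 (σ j) := ⟨by linarith [ht.1], by linarith [ht.2, hSsucc j]⟩
    have hval := hx j _ htj
    change x (S j + (t - S j)) = _ at hval
    rw [add_sub_cancel] at hval
    rw [hval]
    exact (hp j).2.2.2.2.2.1 _ htj
  have hctrl : ∀ᵐ t ∂volume, ∀ j, t ∈ Ico (S j) (S (j + 1)) → ‖u t‖ ≤ M (k + j) := by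
    rw [ae_all_iff]
    intro j
    filter_upwards [(measurePreserving_sub_right volume (S j)).quasiMeasurePreserving.ae
      (hp j).2.2.2.2.2.2] with t ht htj
    have htj' : t - S j ∈ Ico 0 (σ j) := ⟨by linarith [htj.1], by linarith [htj.2, hSsucc j]⟩
    have hval := hu j _ htj'
    change u (S j + (t - S j)) = _ at hval
    rw [add_sub_cancel] at hval
    rw [hval]
    exact ht (Ico_subset_Icc_self htj')
  have hSsum : ∀ j, S j ≤ ∑ i ∈ Finset.range j, τ (k + i) := fun j =>
    Finset.sum_le_sum fun i _ => (hp i).2.2.2.1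
  have hcast : Tendsto (fun j : ℕ => k + (j : ℤ)) atTop atTop :=
    tendsto_atTop_add_const_left _ _ tendsto_natCast_atTop_atTop
  have hBj : Tendsto (fun j : ℕ => B (k + j)) atTop (𝓝 0) := hB.comp hcast
  have hreach : ∀ S₁ : ℝ, T = S₁ → Tendsto (fun t => targetDist C (x t)) (𝓝[<] S₁) (𝓝 0) := by
    intro S₁ hS₁
    rw [tendsto_order]
    refine ⟨fun a ha => Eventually.of_forall fun t => ha.trans_le (targetDist_nonneg _),
      fun ε hε => ?_⟩
    obtain ⟨J, hJ⟩ := eventually_atTop.1 (hBj.eventually (gt_mem_nhds hε))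
    have hJS : S J < S₁ := by
      have := hST J
      rw [hS₁] at this
      exact EReal.coe_lt_coe_iff.1 this
    filter_upwards [Ioo_mem_nhdsLT hJS] with t ht
    obtain ⟨j, hj⟩ := hfind t ⟨(hSnonneg J).trans ht.1.le, by
      rw [hS₁]; exact EReal.coe_lt_coe_iff.2 ht.2⟩
    -- After `S J` only steps `j ≥ J` run, and their overshoots `B (k + j)` are below `ε`.
    have hJj : J ≤ j := Nat.lt_succ_iff.1 (hSmono.lt_iff_lt.1 (ht.1.trans hj.2))
    exact (hdist j t hj).2.trans_lt (hJ j hJj)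
  obtain ⟨ζ, hζ⟩ : ∃ ζ, ∀ S₁ : ℝ, T = S₁ → ζ ∈ terminalPoints C x S₁ := by
    by_cases hfin : ∃ S₁ : ℝ, T = S₁
    · obtain ⟨S₁, hS₁⟩ := hfin
      have hlt : ∀ j, S j < S₁ := fun j => by
        have := hST j
        rw [hS₁] at this
        exact EReal.coe_lt_coe_iff.1 this
      have hlim : Tendsto S atTop (𝓝 S₁) := by
        have := tendsto_atTop_iSup (f := fun j => (S j : EReal))
          fun i j hij => EReal.coe_le_coe_iff.2 (hSmono.monotone hij)
        rw [← hT, hS₁] at this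
        exact EReal.tendsto_coe.1 this
      have hwithin : Tendsto S atTop (𝓝[<] S₁) :=
        tendsto_nhdsWithin_iff.2 ⟨hlim, Eventually.of_forall hlt⟩
      obtain ⟨ζ, hζ⟩ := exists_terminalPoint hC hne hfr (x := x) (b := 2 ^ (-k)) hSmono.monotone
        hSnonneg hlt hlim (fun j => (htraj j).traj_notMem _ ⟨hSnonneg j, le_rfl⟩)
        (fun j => by
          rw [hxS]
          exact (hzs j).2.trans (zpow_le_zpow_right₀ (by norm_num) (by omega)))
        ((hreach S₁ hS₁).comp hwithin)
      exact ⟨ζ, fun S₂ hS₂ => by rwa [← EReal.coe_eq_coe_iff.1 (hS₁.symm.trans hS₂)]⟩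
    · exact ⟨z, fun S₁ hS₁ => absurd ⟨S₁, hS₁⟩ hfin⟩
  classical
  -- The concatenation is arbitrary from `T` on, so it is replaced there by the terminal point.
  let y : ℝ → EuclideanSpace ℝ (Fin n) := fun t => if (t : EReal) < T then x t else ζ
  have hyx : ∀ t : ℝ, (t : EReal) < T → y t = x t := fun t ht => if_pos ht
  have hlt_of : ∀ t ∈ timeInterval T, ∃ j, t < S j := fun t ht => by
    obtain ⟨j, hj⟩ := hfind t ht
    exact ⟨j + 1, hj.2⟩
  have htraj' : ∀ j, IsTrajOn C U f y u (S j) := fun j =>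
    (htraj j).congr (fun t ht => (hyx t ((EReal.coe_le_coe_iff.2 ht.2).trans_lt (hST j))).symm)
      fun _ _ => rfl
  have hT0 : 0 < T := by simpa [hS0] using hST 0
  refine ⟨y, u, T, ⟨hT0, fun t ht => ?_, fun t ht => ?_, fun t ht => ?_, fun t ht => ?_, ?_,
    fun S₁ hS₁ => ?_, fun S₁ hS₁ => ⟨ζ, ?_, fun t ht => ?_⟩⟩, ?_, fun t ht => ?_, ?_,
    fun t ht htT => ?_⟩
  · obtain ⟨j, hj⟩ := hlt_of t ht
    exact (htraj j).control_mem t ⟨ht.1, hj⟩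
  · obtain ⟨j, hj⟩ := hlt_of t ht
    have hr := (htraj j).mono ht.1 hj.le
    obtain ⟨N, hN⟩ := hr.control_bdd
    exact memLp_top_of_bound hr.control_meas N ((ae_restrict_iff' measurableSet_Icc).2 hN)
  · obtain ⟨j, hj⟩ := hlt_of t ht
    exact (htraj' j).traj_notMem t ⟨ht.1, hj.le⟩
  · obtain ⟨j, hj⟩ := hlt_of t ht
    exact ((htraj' j).mono ht.1 hj.le).traj_ac
  · have h0 : ∀ᵐ t ∂(volume : Measure ℝ), t ≠ 0 := by simp [ae_iff, measure_singleton]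
    filter_upwards [h0, ae_all_iff.2 fun j => (htraj' j).ode] with t ht0 ht htT
    obtain ⟨j, hj⟩ := hlt_of t htT
    exact ht j ⟨htT.1.lt_of_ne' ht0, hj⟩
  · refine (hreach S₁ hS₁).congr' ?_
    filter_upwards [self_mem_nhdsWithin] with t ht
    rw [hyx t (by rw [hS₁]; exact EReal.coe_lt_coe_iff.2 ht)]
  · obtain ⟨hfrζ, φ, h1, h2, h3, h4⟩ := hζ S₁ hS₁
    refine ⟨hfrζ, φ, h1, h2, h3, h4.congr fun i => ?_⟩
    rw [hyx _ (by rw [hS₁]; exact EReal.coe_lt_coe_iff.2 (h2 i).2)]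
  · exact if_neg (by rw [hS₁]; exact not_lt.2 (EReal.coe_le_coe_iff.2 ht))
  · rw [hyx 0 (by simpa using hT0), ← hS0, hxS]
    rfl
  · obtain ⟨j, hj⟩ := hfind t ht
    rw [hyx t ht.2]
    exact ⟨j, (hdist j t hj).2, hj.2.trans_le (hSsum _)⟩
  · filter_upwards [hctrl] with t ht htT
    obtain ⟨j, hj⟩ := hfind t htT
    rw [hyx t htT.2]
    exact ⟨j, (hdist j t hj).1, (hdist j t hj).2, ht j hj⟩
  · have hnlt : ¬ (t : EReal) < T := fun hlt => htT ⟨ht, hlt⟩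
    have hyζ : y t = ζ := if_neg hnlt
    have hTtop : T ≠ ⊤ := fun h => hnlt (by rw [h]; exact EReal.coe_lt_top t)
    have hTbot : T ≠ ⊥ := fun h => by rw [h] at hT0; exact absurd hT0 (by simp)
    have hζC := hC.frontier_subset (hζ T.toReal (EReal.coe_toReal hTtop hTbot).symm).1
    rw [hyζ]
    exact Metric.infDist_zero_of_mem hζC

end Control

/-! ### Construction of the `𝒦ℒ` function and of `σ`. -/

/-- A continuous strictly decreasing majorant of a nonincreasing function. -/
theorem Antitone.exists_strictAnti_majorant {g : ℝ → ℝ} (hg : Antitone g) :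
    ∃ G : ℝ → ℝ, Continuous G ∧ StrictAnti G ∧
      ∀ a, g a + Real.exp (-a) ≤ G a ∧ G a ≤ g (a - 1) + Real.exp (-a) := by
  have hint : ∀ a b, IntervalIntegrable g volume a b := fun a b => hg.intervalIntegrable
  have hshift : ∀ a, ∫ s in (a - 1)..a, g s = ∫ s in (-1 : ℝ)..0, g (s + a) := fun a => by
    rw [intervalIntegral.integral_comp_add_right (f := g)]
    ring_nf
  have hga : ∀ a, Antitone fun s => g (s + a) := fun a s t hst => hg (by linarith)
  have hval : ∀ c : ℝ, ∫ _ in (-1 : ℝ)..0, c = c := fun c => by simp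
  -- The mean over `[a - 1, a]` is continuous and at least `g a`; the exponential makes the decrease
  -- strict.
  refine ⟨fun a => (∫ s in (a - 1)..a, g s) + Real.exp (-a), ?_, ?_, fun a => ?_⟩
  · have hp := intervalIntegral.continuous_primitive hint 0
    have : Continuous fun a => ∫ s in (a - 1)..a, g s := by
      refine (hp.sub (hp.comp (continuous_id.sub (continuous_const (y := (1 : ℝ)))))).congr fun a => ?_
      exact intervalIntegral.integral_interval_sub_left (hint _ _) (hint _ _)
    exact this.add (by fun_prop)
  · intro a b hab
    simp only [hshift]
    refine add_lt_add_of_le_of_lt (intervalIntegral.integral_mono_on (by norm_num)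
      (hga b).intervalIntegrable (hga a).intervalIntegrable fun s _ => hg (by linarith)) ?_
    exact Real.exp_lt_exp.2 (by linarith)
  · simp only [hshift]
    constructor
    · gcongr
      rw [← hval (g a)]
      exact intervalIntegral.integral_mono_on (by norm_num) intervalIntegrable_const
        (hga a).intervalIntegrable fun s hs => hg (by linarith [hs.2])
    · gcongr
      rw [← hval (g (a - 1))]
      exact intervalIntegral.integral_mono_on (by norm_num)
        (hga a).intervalIntegrable intervalIntegrable_const fun s hs => hg (by linarith [hs.1])

/-- The coordinate `-log₂ r` sends `r → 0⁺` to `+∞`, so the `𝒦ℒ` properties are limits and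
monotonicity of `P` and `h`. At `r = 0`, joint continuity follows by squeezing between `0` and the
value at `t = 0`. -/
theorem isKL_of_comp {P h : ℝ → ℝ} (hP : Continuous P) (hPanti : StrictAnti P)
    (hPtop : Tendsto P atTop (𝓝 0)) (hPbot : Tendsto P atBot atTop) (hh : Continuous h)
    (hhmono : StrictMono h) (hhtop : Tendsto h atTop atTop) (hhbot : Tendsto h atBot atBot) :
    IsKL fun r t => if r ≤ 0 then 0 else P (h (-Real.logb 2 r) + t) := by
  have hPpos : ∀ a, 0 < P a := fun a =>
    (hPanti.antitone.le_of_tendsto hPtop (a + 1)).trans_lt (hPanti (by linarith))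
  have hlog : ∀ {r r' : ℝ}, 0 < r → r < r' → -Real.logb 2 r' < -Real.logb 2 r := fun hr hrr' =>
    neg_lt_neg (Real.logb_lt_logb (by norm_num) hr hrr')
  have hβpos : ∀ {r : ℝ}, 0 < r → ∀ t,
      (if r ≤ 0 then 0 else P (h (-Real.logb 2 r) + t)) = P (h (-Real.logb 2 r) + t) :=
    fun hr t => if_neg (not_le.2 hr)
  have hlog0 : Tendsto (fun r => -Real.logb 2 r) (𝓝[>] 0) atTop :=
    tendsto_neg_atBot_atTop.comp (Real.tendsto_logb_nhdsGT_zero (by norm_num))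
  have hlogtop : Tendsto (fun r => -Real.logb 2 r) atTop atBot :=
    tendsto_neg_atTop_atBot.comp (Real.tendsto_logb_atTop (by norm_num))
  have hnonneg : ∀ r t : ℝ, 0 ≤ (if r ≤ 0 then 0 else P (h (-Real.logb 2 r) + t)) := fun r t => by
    split_ifs
    exacts [le_rfl, (hPpos _).le]
  refine ⟨?_, fun r _ t _ => hnonneg r t, fun t _ => by simp, fun t ht r hr r' hr' hrr' => ?_,
    fun t ht => ?_, fun r hr t ht t' ht' htt' => ?_, fun r hr => ?_⟩
  · rintro ⟨r, t⟩ ⟨hr, ht⟩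
    simp only [mem_Ici] at hr ht
    rcases hr.eq_or_lt with rfl | hr
    · have h0 : ContinuousWithinAt
          (fun r : ℝ => if r ≤ 0 then 0 else P (h (-Real.logb 2 r) + 0)) (Ici 0) 0 := by
        rw [← continuousWithinAt_Ioi_iff_Ici, ContinuousWithinAt, if_pos le_rfl]
        refine (hPtop.comp (hhtop.comp hlog0)).congr' ?_
        filter_upwards [self_mem_nhdsWithin] with r hr
        rw [hβpos hr, add_zero]
        rfl
      have h1 : Tendsto (fun p : ℝ × ℝ => if p.1 ≤ 0 then 0 else P (h (-Real.logb 2 p.1) + 0))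
          (𝓝[Ici 0 ×ˢ Ici 0] (0, t)) (𝓝 0) := by
        have : Tendsto Prod.fst (𝓝[Ici 0 ×ˢ Ici 0] ((0 : ℝ), t)) (𝓝[Ici 0] 0) :=
          tendsto_nhdsWithin_iff.2 ⟨continuous_fst.continuousAt.mono_left nhdsWithin_le_nhds,
            by filter_upwards [self_mem_nhdsWithin] with p hp using hp.1⟩
        have h2 := h0.tendsto
        rw [if_pos le_rfl] at h2
        exact h2.comp this
      rw [ContinuousWithinAt]
      simp only [le_refl, if_true]
      refine tendsto_of_tendsto_of_tendsto_of_le_of_le' tendsto_const_nhds h1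
        (Eventually.of_forall fun p => hnonneg _ _) ?_
      filter_upwards [self_mem_nhdsWithin] with p hp
      split_ifs
      · exact le_rfl
      · exact hPanti.antitone (by linarith [mem_Ici.1 hp.2])
    · refine ContinuousAt.continuousWithinAt ?_
      have hc : ContinuousAt (fun p : ℝ × ℝ => P (h (-Real.logb 2 p.1) + p.2)) (r, t) := by
        refine hP.continuousAt.comp ((hh.continuousAt.comp ?_).add continuousAt_snd)
        exact ((continuousAt_fst.log hr.ne').div_const _).neg
      refine hc.congr ?_
      filter_upwards [continuousAt_fst.eventually (lt_mem_nhds hr)] with p hp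
      exact (hβpos hp _).symm
  · simp only [mem_Ici] at hr hr'
    have hr'0 : 0 < r' := hr.trans_lt hrr'
    simp only [hβpos hr'0]
    rcases hr.eq_or_lt with rfl | hr
    · simpa using hPpos _
    · rw [hβpos hr]
      exact hPanti (by linarith [hhmono (hlog hr hrr')])
  · have hlim : Tendsto (fun r => if r ≤ 0 then 0 else P (h (-Real.logb 2 r) + t)) atTop atTop := by
      refine (hPbot.comp (tendsto_atBot_add_const_right _ t (hhbot.comp hlogtop))).congr' ?_
      filter_upwards [eventually_gt_atTop 0] with r hr
      exact (hβpos hr t).symm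
    rintro ⟨b, hb⟩
    obtain ⟨r, hr, hr0⟩ :=
      ((hlim.eventually (eventually_gt_atTop b)).and (eventually_ge_atTop 0)).exists
    exact not_le.2 hr (hb (mem_image_of_mem _ hr0))
  · simp only [hβpos hr]
    exact hPanti (by linarith)
  · rcases hr.eq_or_lt with rfl | hr
    · simp
    · simp only [hβpos hr]
      exact hPtop.comp (tendsto_atTop_add_const_left _ _ tendsto_id)

/-- Take a decreasing majorant `P ≥ Θ` and an increasing minorant `-H ≤ a`; then `P (-H + t) ≥ P (a
+ t) ≥ Θ (a + t)`. The exponential terms supply the limits at `-∞`, which `Θ` and `a` need not have.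
-/
theorem exists_isKL_ge {a Θ : ℝ → ℝ} (ha : Monotone a) (hatop : Tendsto a atTop atTop)
    (hΘ : Antitone Θ) (hΘtop : Tendsto Θ atTop (𝓝 0)) :
    ∃ β, IsKL β ∧ ∀ r, 0 < r → ∀ t, Θ (a (-Real.logb 2 r) + t) ≤ β r t := by
  obtain ⟨P, hP, hPanti, hPΘ⟩ := hΘ.exists_strictAnti_majorant
  obtain ⟨H, hH, hHanti, hHa⟩ := ha.neg.exists_strictAnti_majorant
  have hexp0 : Tendsto (fun s : ℝ => Real.exp (-s)) atTop (𝓝 0) := Real.tendsto_exp_neg_atTop_nhds_zero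
  have hexpbot : Tendsto (fun s : ℝ => Real.exp (-s)) atBot atTop :=
    Real.tendsto_exp_atTop.comp tendsto_neg_atBot_atTop
  have hΘ0 : ∀ s, 0 ≤ Θ s := fun s => hΘ.le_of_tendsto hΘtop s
  have hsub : Tendsto (fun s : ℝ => s - 1) atTop atTop := tendsto_atTop_add_const_right _ _ tendsto_id
  refine ⟨_, isKL_of_comp hP hPanti ?_ ?_ hH.neg hHanti.neg ?_ ?_, fun r hr t => ?_⟩
  · refine tendsto_of_tendsto_of_tendsto_of_le_of_le tendsto_const_nhds
      (by simpa using (hΘtop.comp hsub).add hexp0)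
      (fun s => (add_nonneg (hΘ0 s) (Real.exp_pos _).le).trans (hPΘ s).1) fun s => (hPΘ s).2
  · exact tendsto_atTop_mono (fun s => by linarith [(hPΘ s).1, hΘ0 s]) hexpbot
  · refine tendsto_atTop_mono' _ ?_ (tendsto_atTop_add_const_right _ (-1) (hatop.comp hsub))
    filter_upwards [eventually_ge_atTop 0] with s hs
    have h1 := (hHa s).2
    have h2 : Real.exp (-s) ≤ 1 := Real.exp_le_one_iff.2 (by linarith)
    simp only [Pi.neg_apply, Function.comp_apply] at h1 ⊢
    linarith
  · refine tendsto_atBot_mono' _ ?_ (tendsto_atBot_add_const_left _ (a 0)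
      (tendsto_neg_atTop_atBot.comp hexpbot))
    filter_upwards [eventually_le_atBot 0] with s hs
    have h1 := (hHa s).1
    have h2 := ha hs
    simp only [Pi.neg_apply, Function.comp_apply] at h1 ⊢
    linarith
  · rw [if_neg (not_le.2 hr)]
    have h1 := (hPΘ (a (-Real.logb 2 r) + t)).1
    have h2 := (hHa (-Real.logb 2 r)).1
    have h3 := Real.exp_pos (-(a (-Real.logb 2 r) + t))
    have h4 := Real.exp_pos (-(-Real.logb 2 r))
    refine le_trans (by linarith) (hPanti.antitone (?_ : _ ≤ a (-Real.logb 2 r) + t))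
    simp only [Pi.neg_apply] at h2 ⊢
    linarith

theorem exists_int_primitive (τ : ℤ → ℝ) : ∃ A : ℤ → ℝ, ∀ k, A (k + 1) = A k + τ k := by
  refine ⟨fun k => ∑ i ∈ Finset.range k.toNat, τ i - ∑ i ∈ Finset.range (-k).toNat, τ (-i - 1),
    fun k => ?_⟩
  rcases le_or_gt 0 k with hk | hk
  · lift k to ℕ using hk
    have h1 : ((k : ℤ) + 1).toNat = k + 1 := by omega
    have h2 : (-(k : ℤ)).toNat = 0 := by omega
    have h3 : (-((k : ℤ) + 1)).toNat = 0 := by omega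
    simp only [h1, h2, h3, Int.toNat_natCast, Finset.sum_range_succ, Finset.range_zero,
      Finset.sum_empty, sub_zero]
  · obtain ⟨j, rfl⟩ : ∃ j : ℕ, k = -(j : ℤ) - 1 := ⟨(-k - 1).toNat, by omega⟩
    have h1 : (-(j : ℤ) - 1 + 1).toNat = 0 := by omega
    have h2 : (-(j : ℤ) - 1).toNat = 0 := by omega
    have h3 : (-(-(j : ℤ) - 1 + 1)).toNat = j := by omega
    have h4 : (-(-(j : ℤ) - 1)).toNat = j + 1 := by omega
    simp only [h1, h2, h3, h4, Finset.sum_range_succ, Finset.range_zero, Finset.sum_empty]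
    ring

/-- A `𝒦ℒ` bound for quantities that are at most `B (k + j)` until the time
`τ k + ⋯ + τ (k + j)`, if the initial value is in the `k`-th dyadic interval. -/
theorem exists_isKL_of_steps {τ B : ℤ → ℝ} (hτ : ∀ k, 1 ≤ τ k) (hB : Antitone B)
    (hB0 : Tendsto B atTop (𝓝 0)) :
    ∃ β, IsKL β ∧ ∀ (k : ℤ) (r t d : ℝ), (2 : ℝ) ^ (-(k + 1)) < r → r ≤ 2 ^ (-k) →
      (∃ j : ℕ, d ≤ B (k + j) ∧ t < ∑ i ∈ Finset.range (j + 1), τ (k + i)) → d ≤ β r t := by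
  obtain ⟨A, hA⟩ := exists_int_primitive τ
  have hAmono : Monotone A := monotone_int_of_le_succ fun k => by rw [hA]; linarith [hτ k]
  have hAsum : ∀ (k : ℤ) (j : ℕ), A (k + j) = A k + ∑ i ∈ Finset.range j, τ (k + i) := by
    intro k j
    induction j with
    | zero => simp
    | succ j ih => rw [Finset.sum_range_succ, ← add_assoc, ← ih, ← hA]; push_cast; ring_nf
  have hAge : ∀ (k : ℤ) (j : ℕ), A k + j ≤ A (k + j) := fun k j => by
    rw [hAsum]
    gcongr
    simpa using Finset.sum_le_sum fun i (_ : i ∈ Finset.range j) => hτ (k + i)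
  have hBnonneg : ∀ k, 0 ≤ B k := fun k => hB.le_of_tendsto hB0 k
  have hAtop : Tendsto A atTop atTop := tendsto_atTop_atTop_of_monotone hAmono fun b => by
    obtain ⟨j, hj⟩ := exists_nat_ge (b - A 0)
    exact ⟨0 + j, by linarith [hAge 0 j]⟩
  have hne : ∀ s, (B '' {k | A k ≤ s}).Nonempty := fun s => by
    obtain ⟨j, hj⟩ := exists_nat_ge (A 0 - s)
    refine image_nonempty.2 ⟨-(j : ℤ), ?_⟩
    have := hAge (-j) j
    rw [neg_add_cancel] at this
    simp only [mem_ofPred_eq]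
    linarith
  have hbdd : ∀ s, BddBelow (B '' {k | A k ≤ s}) := fun s =>
    ⟨0, by rintro _ ⟨k, -, rfl⟩; exact hBnonneg k⟩
  -- `A` serves as a clock: a start in interval `k` is at clock time `A k`, and every step whose
  -- clock time has passed contributes its bound.
  set Θ : ℝ → ℝ := fun s => sInf (B '' {k | A k ≤ s}) with hΘdef
  have hΘ : Antitone Θ := fun s s' hss' =>
    csInf_le_csInf (hbdd s') (hne s) (image_mono fun k hk => le_trans hk hss')
  have hΘ0 : Tendsto Θ atTop (𝓝 0) := by
    rw [tendsto_order]
    refine ⟨fun c hc => Eventually.of_forall fun s => hc.trans_le ?_, fun ε hε => ?_⟩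
    · exact le_csInf (hne s) (by rintro _ ⟨k, -, rfl⟩; exact hBnonneg k)
    · obtain ⟨k, hk⟩ := (hB0.eventually (gt_mem_nhds hε)).exists
      filter_upwards [eventually_ge_atTop (A k)] with s hs
      exact (csInf_le (hbdd s) (mem_image_of_mem B hs)).trans_lt hk
  have ha : Monotone fun s : ℝ => A ⌊s⌋ := hAmono.comp Int.floor_mono
  have hatop : Tendsto (fun s : ℝ => A ⌊s⌋) atTop atTop := hAtop.comp tendsto_floor_atTop
  obtain ⟨β, hβ, hle⟩ := exists_isKL_ge ha hatop hΘ hΘ0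
  refine ⟨β, hβ, fun k r t d hkr hrk ⟨j, hdj, htj⟩ => ?_⟩
  have hr : 0 < r := lt_trans (by positivity) hkr
  have hfloor : ⌊-Real.logb 2 r⌋ = k := by
    have h1 : Real.logb 2 r ≤ -k := by
      rw [Real.logb_le_iff_le_rpow (by norm_num) hr]
      exact_mod_cast hrk
    have h2 : -(k + 1 : ℝ) < Real.logb 2 r := by
      rw [Real.lt_logb_iff_rpow_lt (by norm_num) hr]
      exact_mod_cast hkr
    rw [Int.floor_eq_iff]
    constructor <;> linarith
  refine le_trans ?_ (hle r hr t)
  rw [hfloor]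
  refine le_csInf (hne _) ?_
  rintro _ ⟨i, hi, rfl⟩
  -- Here `i ≤ k + j`, since `A i ≤ A k + t < A (k + j + 1)`.
  refine hdj.trans (hB ?_)
  by_contra! hlt
  have h1 : A (k + (j + 1 : ℕ)) ≤ A i := hAmono (by push_cast; omega)
  rw [hAsum] at h1
  have h2 : A i ≤ A k + t := hi
  linarith

/-- Near a given `r > 0` only finitely many `k` matter: `2^(-(k+1)) ≤ r` bounds `k` below, and `r ≤
B k → 0` bounds it above. A constant therefore works locally, and convexity of the constraints
allows gluing, in the variable `log r`. -/
theorem exists_continuousOn_majorant (M : ℤ → ℝ) {B : ℤ → ℝ} (hB0 : Tendsto B atTop (𝓝 0)) :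
    ∃ σ : ℝ → ℝ, ContinuousOn σ (Ioi 0) ∧ (∀ r, 0 < r → 0 < σ r) ∧
      ∀ (k : ℤ) (r : ℝ), (2 : ℝ) ^ (-(k + 1)) ≤ r → r ≤ B k → M k ≤ σ r := by
  obtain ⟨g, hg⟩ := exists_continuous_forall_mem_convex_of_local_const (X := ℝ) (E := ℝ)
    (t := fun y => Ioi 0 ∩ ⋂ k ∈ {k : ℤ | (2 : ℝ) ^ (-(k + 1)) ≤ Real.exp y ∧ Real.exp y ≤ B k},
      Ici (M k))
    (fun y => (convex_Ioi 0).inter (convex_iInter₂ fun k _ => convex_Ici _)) fun y => by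
      obtain ⟨N, hN⟩ := pow_unbounded_of_one_lt (Real.exp (y + 1)) (one_lt_two)
      obtain ⟨K, hK⟩ := eventually_atTop.1 (hB0.eventually (gt_mem_nhds (Real.exp_pos (y - 1))))
      refine ⟨1 + ∑ k ∈ Finset.Icc (-(N : ℤ) - 1) K, |M k|, ?_⟩
      have hsum : 0 ≤ ∑ k ∈ Finset.Icc (-(N : ℤ) - 1) K, |M k| :=
        Finset.sum_nonneg fun _ _ => abs_nonneg _
      filter_upwards [Ioo_mem_nhds (sub_one_lt y) (lt_add_one y)] with y' hy'
      refine ⟨by simp only [mem_Ioi]; linarith, mem_iInter₂.2 fun k hk => ?_⟩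
      have hkN : -(N : ℤ) - 1 ≤ k := by
        by_contra! hlt
        have h1 : (2 : ℝ) ^ (N : ℤ) ≤ 2 ^ (-(k + 1)) :=
          zpow_le_zpow_right₀ (by norm_num) (by omega)
        rw [zpow_natCast] at h1
        have h2 := Real.exp_le_exp.2 hy'.2.le
        linarith [hk.1]
      have hkK : k ≤ K := by
        by_contra! hlt
        have h1 := hK k hlt.le
        have h2 := Real.exp_le_exp.2 hy'.1.le
        linarith [hk.2]
      have := Finset.single_le_sum (f := fun k => |M k|) (fun _ _ => abs_nonneg _)
        (Finset.mem_Icc.2 ⟨hkN, hkK⟩)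
      simp only [mem_Ici]
      linarith [le_abs_self (M k)]
  refine ⟨fun r => g (Real.log r), g.continuous.comp_continuousOn
    (Real.continuousOn_log.mono fun r hr => (ne_of_gt hr : r ≠ 0)), fun r _ => (hg _).1,
    fun k r hkr hrk => ?_⟩
  have hr : 0 < r := lt_of_lt_of_le (by positivity) hkr
  exact mem_iInter₂.1 (hg (Real.log r)).2 k (by rw [mem_ofPred_eq, Real.exp_log hr]; exact ⟨hkr, hrk⟩)

/-! ### The equivalence. -/

theorem theorem2p1 (n m : ℕ)
    (C : Set (EuclideanSpace ℝ (Fin n))) (hC_closed : IsClosed C) (hC_nonempty : C.Nonempty)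
    (hC_frontier : IsCompact (frontier C))
    (U : Set (EuclideanSpace ℝ (Fin m))) (hU_closed : IsClosed U)
    (hU_cone : ∀ u ∈ U, ∀ r : ℝ, 0 < r → r • u ∈ U)
    (f : EuclideanSpace ℝ (Fin n) → EuclideanSpace ℝ (Fin m) → EuclideanSpace ℝ (Fin n))
    (hf : HypHl C U f) :
    IsGAC C U f ↔
      ∃ σ : ℝ → ℝ, ContinuousOn σ (Ioi 0) ∧ (∀ r, 0 < r → 0 < σ r) ∧ IsGACWith C U f σ := by
  constructor
  · rintro ⟨β, hβ, hgac⟩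
    have hR : ∀ k : ℤ, (2 : ℝ) ^ (-(k + 1)) = 2 ^ (-k) / 2 := fun k => by
      rw [neg_add, zpow_add₀ (by norm_num)]
      norm_num
      ring
    choose M τ hτ hstep using fun k : ℤ => exists_halving_steps hC_closed hC_nonempty hC_frontier
      hU_closed hf hβ hgac (r := (2 : ℝ) ^ (-k)) (by positivity)
    simp only [← hR] at hstep
    set B : ℤ → ℝ := fun k => β (2 ^ (-k)) 0 + 2 ^ (-k) with hBdef
    have hRanti : Antitone fun k : ℤ => (2 : ℝ) ^ (-k) := fun k l hkl =>
      zpow_le_zpow_right₀ (by norm_num) (neg_le_neg hkl)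
    have hR0 : Tendsto (fun k : ℤ => (2 : ℝ) ^ (-k)) atTop (𝓝 0) := by
      rw [tendsto_order]
      refine ⟨fun c hc => Eventually.of_forall fun k => hc.trans (by positivity), fun ε hε => ?_⟩
      obtain ⟨N, hN⟩ := exists_pow_lt_of_lt_one hε (one_half_lt_one (α := ℝ))
      filter_upwards [eventually_ge_atTop (N : ℤ)] with k hk
      refine (hRanti hk).trans_lt ?_
      simpa using hN
    have hB : Antitone B := fun k l hkl => add_le_add
      ((hβ.strictMonoOn 0 le_rfl).monotoneOn (mem_Ici.2 (by positivity)) (mem_Ici.2 (by positivity))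
        (hRanti hkl)) (hRanti hkl)
    -- Joint continuity of `β` at the origin and `β 0 0 = 0` make the overshoots vanish.
    have hB0 : Tendsto B atTop (𝓝 0) := by
      have h1 : Tendsto (fun k : ℤ => ((2 : ℝ) ^ (-k), (0 : ℝ))) atTop
          (𝓝[Ici 0 ×ˢ Ici 0] ((0 : ℝ), (0 : ℝ))) :=
        tendsto_nhdsWithin_iff.2 ⟨hR0.prodMk_nhds tendsto_const_nhds,
          Eventually.of_forall fun k => ⟨mem_Ici.2 (by positivity), mem_Ici.2 le_rfl⟩⟩
      have h2 := (hβ.continuousOn (0, 0) ⟨mem_Ici.2 le_rfl, mem_Ici.2 le_rfl⟩).tendsto.comp h1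
      have h3 := h2.add hR0
      simp only [hβ.zero 0 le_rfl, add_zero] at h3
      exact h3
    obtain ⟨γ, hγ, hγle⟩ := exists_isKL_of_steps hτ hB hB0
    obtain ⟨σ, hσcont, hσpos, hσ⟩ := exists_continuousOn_majorant M hB0
    refine ⟨σ, hσcont, hσpos, γ, hγ, fun z hz => ?_⟩
    have hdz : 0 < targetDist C z := (targetDist_pos_iff hC_closed hC_nonempty).2 hz
    obtain ⟨i, hi, hi'⟩ := exists_mem_Ioc_zpow hdz (one_lt_two)
    obtain ⟨k, rfl⟩ : ∃ k : ℤ, i = -(k + 1) := ⟨-i - 1, by ring⟩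
    have hzk : targetDist C z ≤ 2 ^ (-k) := by
      rwa [show -(k + 1) + 1 = -k by ring] at hi'
    obtain ⟨x, u, T, hadm, hx0, hdist, hctrl, hout⟩ := exists_admissible_of_halving_steps hC_closed
      hC_nonempty hC_frontier hB0 hstep hi hzk
    refine ⟨x, u, T, hadm, hx0, fun t ht => ?_, ?_⟩
    · by_cases htT : t ∈ timeInterval T
      · exact hγle k _ t _ hi hzk (hdist t htT)
      · rw [hout t ht htT]
        exact hγ.nonneg _ hdz.le t ht
    · filter_upwards [hctrl] with t ht htT
      obtain ⟨j, h1, h2, h3⟩ := ht htT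
      exact h3.trans (hσ _ _ h1 h2)
  · rintro ⟨σ, -, -, β, hβ, h⟩
    refine ⟨β, hβ, fun z hz => ?_⟩
    obtain ⟨x, u, T, h1, h2, h3, -⟩ := h z hz
    exact ⟨x, u, T, h1, h2, h3⟩
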